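/- **Replica Counting, Multiple policy.** An instance consists of a finite rooted tree whose vertices are partitioned into a set $\mathcal N$ of internal nodes, containing the root, and a set $\mathcal C$ of clients, which are leaves attached to internal nodes; a number $r_i\in\mathbb N$ of requests for each client $i\in\mathcal C$; and a capacity $W\in\mathbb N$ common to all internal nodes. A valid solution (under the Multiple policy, without quality-of-service or link-capacity constraints) is a family of natural numbers $(r_{i,s})_{i\in\mathcal C,\,s\in\mathcal N}$, where $r_{i,s}$ is the number of requests of client $i$ processed by node $s$, such that - $r_{i,s}=0$ unless $s$ lies on the path from $i$ to the root; - $\sum_{s\in\mathcal N} r_{i,s}=r_i$ for every $i\in\mathcal C$; - $\sum_{i\in\mathcal C} r_{i,s}\le W$ for every $s\in R$, where $R=\{s\in\mathcal N : r_{i,s}>0 \text{ for some } i\in\mathcal C\}$ is the set of replicas. The Replica Counting problem asks for a valid solution that minimizes $|R|$. **Theorem.** The Replica Counting problem with the Multiple policy can be solved in polynomial time: there are an algorithm and a polynomial $p$ such that, for every instance of bit size $n$ (all numbers written in binary), the algorithm halts within time $p(n)$ and outputs a valid solution $(r_{i,s})$ with the minimum number $|R|$ of replicas if a valid solution exists,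 and reports that there is none otherwise. Here time is the logarithmic cost on a random access machine with addition, truncated subtraction, comparison and indirect addressing. -/

import Mathlib

/-!
Random access machines with logarithmic (bit) cost, polynomial time over them, and the
replica counting problem on a distribution tree under the Multiple access policy.
-/

namespace RAM

/-- The state of a random access machine: registers, and arrays of natural numbers.
A program names its registers and arrays by constants, so it uses finitely many of them;
array cells are addressed by computed values. -/
structure State where
  reg : ℕ → ℕ
  arr : ℕ → ℕ → ℕ

/-- Arithmetic expressions: constants, the content of a register, the content of the cell of
array `k` at a computed address, sums, and truncated differences. There is no multiplication. -/
inductive Expr where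
  | lit (n : ℕ)
  | reg (r : ℕ)
  | get (k : ℕ) (idx : Expr)
  | add (a b : Expr)
  | sub (a b : Expr)

/-- The value of an expression in a state. -/
def Expr.eval (s : State) : Expr → ℕ
  | .lit n => n
  | .reg r => s.reg r
  | .get k idx => s.arr k (idx.eval s)
  | .add a b => a.eval s + b.eval s
  | .sub a b => a.eval s - b.eval s

/-- The logarithmic cost of evaluating an expression: every subexpression is charged one plus
the bit length of its value (in particular an array access is charged for the bit lengths of
both the address and the content). -/
def Expr.cost (s : State) : Expr → ℕ
  | .lit n => Nat.size n + 1
  | .reg r => Nat.size (s.reg r) + 1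
  | .get k idx => Nat.size (s.arr k (idx.eval s)) + 1 + idx.cost s
  | .add a b => Nat.size (a.eval s + b.eval s) + 1 + a.cost s + b.cost s
  | .sub a b => Nat.size (a.eval s - b.eval s) + 1 + a.cost s + b.cost s

/-- Structured programs. The tests of conditionals and loops compare two expressions:
`ite a b p q` is `if a < b then p else q`, and `loop a b p` is `while a < b do p`. -/
inductive Prog where
  | skip
  | setReg (r : ℕ) (e : Expr)
  | setArr (k : ℕ) (idx e : Expr)
  | seq (p q : Prog)
  | ite (a b : Expr) (p q : Prog)
  | loop (a b : Expr) (p : Prog)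

/-- `s.setReg r v` is `s` after register `r` has been overwritten by `v`. -/
def State.setReg (s : State) (r v : ℕ) : State :=
  { s with reg := Function.update s.reg r v }

/-- `s.setArr k i v` is `s` after cell `i` of array `k` has been overwritten by `v`. -/
def State.setArr (s : State) (k i v : ℕ) : State :=
  { s with arr := Function.update s.arr k (Function.update (s.arr k) i v) }

/-- `Exec p s t s'`: started in state `s`, the program `p` halts in state `s'` after a run of
total logarithmic cost `t`. -/
inductive Exec : Prog → State → ℕ → State → Prop where
  | skip (s : State) : Exec .skip s 1 s
  | setReg (s : State) (r : ℕ) (e : Expr) :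
      Exec (.setReg r e) s (1 + e.cost s) (s.setReg r (e.eval s))
  | setArr (s : State) (k : ℕ) (idx e : Expr) :
      Exec (.setArr k idx e) s (1 + idx.cost s + e.cost s)
        (s.setArr k (idx.eval s) (e.eval s))
  | seq {p q : Prog} {s s' s'' : State} {t t' : ℕ} :
      Exec p s t s' → Exec q s' t' s'' → Exec (.seq p q) s (t + t') s''
  | iteTrue {a b : Expr} {p q : Prog} {s s' : State} {t : ℕ} :
      a.eval s < b.eval s → Exec p s t s' →
        Exec (.ite a b p q) s (1 + a.cost s + b.cost s + t) s'
  | iteFalse {a b : Expr} {p q : Prog} {s s' : State} {t : ℕ} :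
      ¬ a.eval s < b.eval s → Exec q s t s' →
        Exec (.ite a b p q) s (1 + a.cost s + b.cost s + t) s'
  | loopDone {a b : Expr} {p : Prog} {s : State} :
      ¬ a.eval s < b.eval s →
        Exec (.loop a b p) s (1 + a.cost s + b.cost s) s
  | loopStep {a b : Expr} {p : Prog} {s s' s'' : State} {t t' : ℕ} :
      a.eval s < b.eval s → Exec p s t s' → Exec (.loop a b p) s' t' s'' →
        Exec (.loop a b p) s (1 + a.cost s + b.cost s + t + t') s''

/-- The initial state on input `xs`: register `0` holds the number of input words, array `0`
holds the words, and everything else is zero. -/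
def initState (xs : List ℕ) : State where
  reg r := if r = 0 then xs.length else 0
  arr k i := if k = 0 then xs.getD i 0 else 0

/-- The output read off a final state: the first `n` cells of array `1`, where `n` is the content
of register `0`. -/
def State.output (s : State) : List ℕ :=
  (List.range (s.reg 0)).map (s.arr 1)

/-- The bit size of a list of numbers written in binary (each word is charged one extra
symbol as a separator). -/
def bitSize (xs : List ℕ) : ℕ :=
  (xs.map fun x => Nat.size x + 1).sum

/-- The function `f`, whose arguments are encoded by `encIn` and whose values are encoded by
`encOut`, is computable in polynomial time: one program computes it on all arguments, and a
polynomial in the bit size of the input bounds the cost of the run together with the bit size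
of the output. -/
def PolyTimeComputable {α : Type} {β : α → Type} (encIn : α → List ℕ)
    (encOut : (a : α) → β a → List ℕ) (f : (a : α) → β a) : Prop :=
  ∃ (P : Prog) (p : Polynomial ℕ), ∀ a : α, ∃ (t : ℕ) (s : State),
    Exec P (initState (encIn a)) t s ∧
    s.output = encOut a (f a) ∧
    t + bitSize (encOut a (f a)) ≤ p.eval (bitSize (encIn a))

end RAM

namespace ReplicaCounting

/-- An instance of replica counting: a rooted tree whose internal nodes are `Fin numNodes` and
whose clients `Fin numClients` are leaves hanging below internal nodes, the numbers of requests
of the clients, and the common processing capacity of the nodes. The labels are arbitrary; the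
root is, by convention, its own parent. -/
structure Instance where
  numNodes : ℕ
  numClients : ℕ
  root : Fin numNodes
  /-- the parent of an internal node -/
  parent : Fin numNodes → Fin numNodes
  parent_root : parent root = root
  reaches_root : ∀ j, ∃ k : ℕ, parent^[k] j = root
  /-- the parent of a client -/
  clientParent : Fin numClients → Fin numNodes
  /-- the number of requests per time unit of a client -/
  requests : Fin numClients → ℕ
  /-- the number of requests per time unit that a server can process -/
  capacity : ℕ

namespace Instance

/-- The nodes on the path from client `i` up to the root (`i` excluded). -/
def ancestors (I : Instance) (i : Fin I.numClients) : Set (Fin I.numNodes) :=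
  {s | ∃ k : ℕ, I.parent^[k] (I.clientParent i) = s}

/-- An assignment `y` gives, for each client `i` and node `s`, the number `y i s` of requests
of `i` that are processed by `s`. -/
abbrev Assignment (I : Instance) : Type :=
  Fin I.numClients → Fin I.numNodes → ℕ

/-- The replicas of an assignment: the nodes that process at least one request. -/
def replicas (I : Instance) (y : I.Assignment) : Finset (Fin I.numNodes) :=
  {s | ∃ i, y i s ≠ 0}

/-- The assignment is a valid solution under the Multiple policy: the requests of a client are
processed by nodes on its path to the root, possibly by several ones; all requests are
processed; and no server capacity is exceeded. -/
structure IsValid (I : Instance) (y : I.Assignment) : Prop where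
  path : ∀ i s, y i s ≠ 0 → s ∈ I.ancestors i
  served : ∀ i, ∑ s, y i s = I.requests i
  capacity : ∀ s ∈ I.replicas y, ∑ i, y i s ≤ I.capacity

/-- The assignment is a valid solution with the minimum number of replicas. -/
def IsOptimal (I : Instance) (y : I.Assignment) : Prop :=
  I.IsValid y ∧ ∀ y' : I.Assignment, I.IsValid y' → (I.replicas y).card ≤ (I.replicas y').card

/-- The instance as a list of numbers: the capacity, the number of nodes, the number of clients,
the root, the parents of the nodes, the parents of the clients, the requests of the clients. -/
def encode (I : Instance) : List ℕ :=
  [I.capacity, I.numNodes, I.numClients, (I.root : ℕ)] ++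
    List.ofFn (fun j => (I.parent j : ℕ)) ++
    List.ofFn (fun i => (I.clientParent i : ℕ)) ++
    List.ofFn I.requests

/-- The answer as a list of numbers: `[0]` for "no solution", and otherwise `1` followed by the
table of the assignment, client by client. -/
def encodeAnswer (I : Instance) : Option I.Assignment → List ℕ
  | none => [0]
  | some y => 1 :: (List.ofFn fun i => List.ofFn (y i)).flatten

end Instance

end ReplicaCounting

/-! The mathematical core is greedy. Once the set of replicas is fixed, every replica should serve
as many waiting requests as it can before the rest move to its parent: serving low never hurts,
since a request passed upwards retains only the options above. Visiting nodes from the leaves to the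
root, the set suffices exactly when no request is left at the root. `flow` is this process,
`flow_eq_zero_of_assignment` shows that it does at least as well as any assignment, and
`waiting_curAt` with `sum_assign` turns a successful flow back into an assignment to individual
clients.

It remains to choose the set. The greedy process only sees the number of requests that leave a
subtree, so one keeps, for each node and each budget `k`, the least such number over choices of at
most `k` replicas. Subtrees are merged by infimal convolution of these rows. The lemmas
`exists_flow_le_table` and `exists_table_le_flow` say that the table is attained by actual sets and
bounds every set from below, so the least zero `K` in the row of the root is the optimal number. The
number of requests is never an index, which is why binary numbers do no harm.

An optimal set is recovered by self-reduction instead of backtracking: nodes are disabled one at a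
time whenever `K` replicas still suffice. Any node that remains enabled lies in every `K`-element
solution, so at most `K` nodes remain (`thin_spec`).

For the running time, all loops are bounded by the length of the input. Without multiplication an
assignment increases the maximal bit length by at most a constant. Hence the number of steps, the
bit lengths and the logarithmic cost are all polynomial (`costs_compile`, `exists_polynomial_time`).
The program works on breadth-first positions, so that parents precede children, and looks up
multiples of row lengths in precomputed arrays. `solveProg_correct` joins the two halves. -/

namespace RAM

/-! ### Programs whose loops are bounded by the length of the input -/

/-- Structured programs with bounded loops only: `forN r e p` executes `p` for the values
`0, 1, 2, …` of register `r` below `e` and below the content of register `0`. -/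
inductive FProg where
  | skip
  | setReg (r : ℕ) (e : Expr)
  | setArr (k : ℕ) (idx e : Expr)
  | seq (p q : FProg)
  | ite (a b : Expr) (p q : FProg)
  | forN (r : ℕ) (e : Expr) (p : FProg)

/-- `iter f k s` applies `f 0`, …, `f (k - 1)` in turn, starting from `s`. -/
def iter (f : ℕ → State → State) : ℕ → State → State
  | 0, s => s
  | k + 1, s => f k (iter f k s)

namespace FProg

/-- The final state of a run. -/
def run : FProg → State → State
  | skip => fun s => s
  | setReg r e => fun s => s.setReg r (e.eval s)
  | setArr k idx e => fun s => s.setArr k (idx.eval s) (e.eval s)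
  | seq p q => fun s => run q (run p s)
  | ite a b p q => fun s => if a.eval s < b.eval s then run p s else run q s
  | forN r e p => fun s =>
      iter (fun k s' => (if k < e.eval s' then run p s' else s').setReg r (k + 1))
        (s.reg 0) (s.setReg r 0)

/-- Translation into the language of random access machines. -/
def compile : FProg → Prog
  | skip => .skip
  | setReg r e => .setReg r e
  | setArr k idx e => .setArr k idx e
  | seq p q => .seq p.compile q.compile
  | ite a b p q => .ite a b p.compile q.compile
  | forN r e p => .seq (.setReg r (.lit 0)) (.loop (.reg r) (.reg 0)
      (.seq (.ite (.reg r) e p.compile .skip) (.setReg r (.add (.reg r) (.lit 1)))))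

/-- Does the program contain an assignment to register `x`? -/
def writesReg (x : ℕ) : FProg → Bool
  | skip => false
  | setReg r _ => r == x
  | setArr _ _ _ => false
  | seq p q => p.writesReg x || q.writesReg x
  | ite _ _ p q => p.writesReg x || q.writesReg x
  | forN r _ p => r == x || p.writesReg x

/-- Does the program contain an assignment to a cell of array `x`? -/
def writesArr (x : ℕ) : FProg → Bool
  | skip => false
  | setReg _ _ => false
  | setArr k _ _ => k == x
  | seq p q => p.writesArr x || q.writesArr x
  | ite _ _ p q => p.writesArr x || q.writesArr x
  | forN _ _ p => p.writesArr x

/-- No loop body assigns to the counter of the loop or to register `0`. -/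
def wf : FProg → Bool
  | skip => true
  | setReg _ _ => true
  | setArr _ _ _ => true
  | seq p q => p.wf && q.wf
  | ite _ _ p q => p.wf && q.wf
  | forN r _ p => p.wf && !p.writesReg r && !p.writesReg 0 && !(r == 0)

end FProg

/-! ### State updates and the frame rule -/

@[simp] theorem State.setReg_reg (s : State) (r v x : ℕ) :
    (s.setReg r v).reg x = if x = r then v else s.reg x := by
  simp [State.setReg, Function.update_apply]

@[simp] theorem State.setReg_arr (s : State) (r v : ℕ) : (s.setReg r v).arr = s.arr := rfl

@[simp] theorem State.setArr_reg (s : State) (k i v : ℕ) : (s.setArr k i v).reg = s.reg := rfl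

theorem State.setArr_arr (s : State) (k i v x : ℕ) :
    (s.setArr k i v).arr x = if x = k then Function.update (s.arr k) i v else s.arr x := by
  simp only [State.setArr, Function.update_apply]

@[simp] theorem State.setArr_arr_apply (s : State) (k i v x y : ℕ) :
    (s.setArr k i v).arr x y = if x = k ∧ y = i then v else s.arr x y := by
  simp only [State.setArr_arr]
  by_cases h : x = k
  · subst h; simp [Function.update_apply]
  · simp [h]

theorem iter_ind {f : ℕ → State → State} {s : State} {n : ℕ} (P : ℕ → State → Prop)
    (h0 : P 0 s) (hs : ∀ k s', k < n → P k s' → P (k + 1) (f k s')) : P n (iter f n s) := by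
  induction n with
  | zero => exact h0
  | succ n ih =>
    exact hs _ _ (Nat.lt_succ_self _) (ih fun k s' hk => hs k s' (Nat.lt_succ_of_lt hk))

namespace FProg

/-- `s'` agrees with `s` in everything to which `p` contains no assignment. -/
structure Agree (p : FProg) (s s' : State) : Prop where
  reg : ∀ x, p.writesReg x = false → s'.reg x = s.reg x
  arr : ∀ x, p.writesArr x = false → s'.arr x = s.arr x

/-- The frame rule. Its side conditions are Boolean computations on the program text, so for a
concrete program they hold by `rfl`; this is how all later proofs carry registers and arrays past a
subprogram. -/
theorem agree_run (p : FProg) (s : State) : Agree p s (p.run s) := by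
  induction p generalizing s with
  | skip => exact ⟨fun _ _ => rfl, fun _ _ => rfl⟩
  | setReg r e =>
    refine ⟨fun x hx => ?_, fun _ _ => rfl⟩
    have : x ≠ r := by rintro rfl; simp [writesReg] at hx
    simp [run, this]
  | setArr k i e =>
    refine ⟨fun _ _ => rfl, fun x hx => ?_⟩
    have : x ≠ k := by rintro rfl; simp [writesArr] at hx
    simp [run, State.setArr_arr, this]
  | seq p q hp hq =>
    refine ⟨fun x hx => ?_, fun x hx => ?_⟩
    · simp only [writesReg, Bool.or_eq_false_iff] at hx
      exact ((hq _).reg x hx.2).trans ((hp _).reg x hx.1)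
    · simp only [writesArr, Bool.or_eq_false_iff] at hx
      exact ((hq _).arr x hx.2).trans ((hp _).arr x hx.1)
  | ite a b p q hp hq =>
    refine ⟨fun x hx => ?_, fun x hx => ?_⟩
    · simp only [writesReg, Bool.or_eq_false_iff] at hx
      simp only [run]
      split_ifs
      exacts [(hp _).reg x hx.1, (hq _).reg x hx.2]
    · simp only [writesArr, Bool.or_eq_false_iff] at hx
      simp only [run]
      split_ifs
      exacts [(hp _).arr x hx.1, (hq _).arr x hx.2]
  | forN r e p hp =>
    refine ⟨fun x hx => ?_, fun x hx => ?_⟩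
    · simp only [writesReg, Bool.or_eq_false_iff] at hx
      have hr : x ≠ r := by rintro rfl; simp at hx
      refine iter_ind (fun _ s' => s'.reg x = s.reg x) (by simp [hr]) fun k s' _ h => ?_
      simp only [State.setReg_reg, if_neg hr]
      split_ifs
      exacts [((hp _).reg x hx.2).trans h, h]
    · simp only [writesArr] at hx
      refine iter_ind (fun _ s' => s'.arr x = s.arr x) rfl fun k s' _ h => ?_
      simp only [State.setReg_arr]
      split_ifs
      exacts [((hp _).arr x hx).trans h, h]

theorem run_reg (p : FProg) (s : State) (x : ℕ) (h : p.writesReg x = false) :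
    (p.run s).reg x = s.reg x := (agree_run p s).reg x h

theorem run_arr (p : FProg) (s : State) (x : ℕ) (h : p.writesArr x = false) :
    (p.run s).arr x = s.arr x := (agree_run p s).arr x h

/-- The invariant rule for loops. -/
theorem run_forN {q : FProg} {r : ℕ} {e : Expr} {p : FProg} (hq : q = forN r e p) {s : State}
    {m : ℕ} (P : ℕ → State → Prop) (hwf : q.wf = true) (hm : m ≤ s.reg 0)
    (he : ∀ s', Agree q s s' → e.eval s' = m)
    (hP : ∀ k s' x, P k s' → P k (s'.setReg r x))
    (h0 : P 0 s)
    (hs : ∀ k s', k < m → s'.reg r = k → Agree q s s' → P k s' →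
      P (k + 1) (p.run s')) :
    P m (q.run s) := by
  subst hq
  simp only [wf, Bool.and_eq_true, Bool.not_eq_true'] at hwf
  -- The compiled loop always makes `s.reg 0` rounds, but the guard lets the body run only in the
  -- first `m` of them. Hence the invariant is taken at `min k m`.
  have key := iter_ind (f := fun k s' => (if k < e.eval s' then run p s' else s').setReg r (k + 1))
    (s := s.setReg r 0) (n := s.reg 0)
    (fun k s' => s'.reg r = k ∧ Agree (forN r e p) s s' ∧ P (min k m) s') ?_ ?_
  · have := key.2.2
    rwa [min_eq_right hm] at this
  · refine ⟨by simp, ⟨fun x hx => ?_, fun x _ => rfl⟩, by simpa using hP _ _ _ h0⟩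
    have hr : x ≠ r := by rintro rfl; simp [writesReg] at hx
    simp [hr]
  · rintro k s' - ⟨hr, ha, h⟩
    have hag : ∀ s'', Agree p s' s'' → Agree (forN r e p) s (s''.setReg r (k + 1)) := by
      intro s'' h''
      refine ⟨fun x hx => ?_, fun x hx => ?_⟩
      · have hxr : x ≠ r := by rintro rfl; simp [writesReg] at hx
        rw [← ha.reg x hx]
        simp only [writesReg, Bool.or_eq_false_iff] at hx
        simp only [State.setReg_reg, if_neg hxr]
        exact h''.reg x hx.2
      · rw [← ha.arr x hx]
        exact h''.arr x hx
    refine ⟨by simp, ?_, ?_⟩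
    · split_ifs
      · exact hag _ (agree_run _ _)
      · exact hag _ ⟨fun _ _ => rfl, fun _ _ => rfl⟩
    · apply hP
      rw [he _ ha]
      split_ifs with hk
      · rw [min_eq_left hk.le] at h
        rw [min_eq_left (Nat.succ_le_of_lt hk)]
        exact hs k s' hk hr ha h
      · rw [min_eq_right (not_lt.mp hk)] at h
        rwa [min_eq_right (Nat.le_succ_of_le (not_lt.mp hk))]

end FProg

/-! ### Running time -/

/-- All registers and cells hold numbers of bit length at most `b`. -/
def Bounded (s : State) (b : ℕ) : Prop :=
  (∀ r, s.reg r < 2 ^ b) ∧ ∀ k i, s.arr k i < 2 ^ b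

theorem Bounded.mono {s : State} {b b' : ℕ} (h : Bounded s b) (hb : b ≤ b') : Bounded s b' :=
  have := Nat.pow_le_pow_right (n := 2) (by norm_num) hb
  ⟨fun r => (h.1 r).trans_le this, fun k i => (h.2 k i).trans_le this⟩

/-- A measure of the length of an expression. -/
def Expr.weight : Expr → ℕ
  | .lit n => Nat.size n + 2
  | .reg _ => 2
  | .get _ i => i.weight + 2
  | .add a b => a.weight + b.weight + 2
  | .sub a b => a.weight + b.weight + 2

/-- A sum is at most one bit longer than its longer summand and a truncated difference is no longer
than its first argument, so evaluation adds to the bit length an amount that depends on the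
expression only. -/
theorem Expr.eval_lt {s : State} {b : ℕ} (h : Bounded s b) (e : Expr) :
    e.eval s < 2 ^ (b + e.weight) := by
  have mono : ∀ {x y z : ℕ}, x < 2 ^ y → y ≤ z → x < 2 ^ z := fun h1 h2 =>
    h1.trans_le (Nat.pow_le_pow_right (by norm_num) h2)
  induction e with
  | lit n => exact mono (Nat.lt_size_self n) (by simp only [weight]; omega)
  | reg r => exact mono (h.1 r) (by omega)
  | get k i _ => exact mono (h.2 k _) (by omega)
  | add x y hx hy =>
    have h1 := mono hx (z := b + x.weight + y.weight) (by omega)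
    have h2 := mono hy (z := b + x.weight + y.weight) (by omega)
    refine mono (y := b + x.weight + y.weight + 1) ?_ (by simp only [weight]; omega)
    simp only [eval]
    rw [pow_succ]; omega
  | sub x y hx _ =>
    exact mono ((Nat.sub_le _ _).trans_lt hx) (by simp only [weight]; omega)

theorem Expr.cost_le {s : State} {b : ℕ} (h : Bounded s b) (e : Expr) :
    e.cost s ≤ e.weight * (b + e.weight) := by
  induction e with
  | lit n => simp only [cost, weight]; nlinarith
  | reg r =>
    have := Nat.size_le.2 (h.1 r)
    simp only [cost, weight]; omega
  | get k i hi =>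
    have := Nat.size_le.2 (h.2 k (i.eval s))
    simp only [cost, weight]; nlinarith
  | add x y hx hy =>
    have := Nat.size_le.2 (Expr.eval_lt h (.add x y))
    simp only [cost, weight, eval] at *
    nlinarith [Nat.zero_le (x.weight * y.weight)]
  | sub x y hx hy =>
    have := Nat.size_le.2 (Expr.eval_lt h (.sub x y))
    simp only [cost, weight, eval] at *
    nlinarith [Nat.zero_le (x.weight * y.weight)]

/-- The program `P` leads from `s` to `s'`, and `g` bounds the growth of the bit length of the
contents as well as, relative to the bit length reached, the cost. -/
def Costs (P : Prog) (s s' : State) (g : ℕ) : Prop :=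
  ∀ b, Bounded s b → ∃ t, Exec P s t s' ∧ t ≤ g * (b + g) ∧ Bounded s' (b + g)

theorem Costs.mono {P : Prog} {s s' : State} {g g' : ℕ} (h : Costs P s s' g) (hg : g ≤ g') :
    Costs P s s' g' := by
  intro b hb
  obtain ⟨t, h1, h2, h3⟩ := h b hb
  exact ⟨t, h1, h2.trans (Nat.mul_le_mul hg (by omega)), h3.mono (by omega)⟩

theorem Costs.skip (s : State) : Costs .skip s s 1 := fun b hb =>
  ⟨1, .skip s, by omega, hb.mono (by omega)⟩

theorem Costs.setReg (s : State) (r : ℕ) (e : Expr) :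
    Costs (.setReg r e) s (s.setReg r (e.eval s)) (e.weight + 1) := by
  intro b hb
  refine ⟨_, .setReg s r e, ?_, fun x => ?_, fun k i => ?_⟩
  · have := Expr.cost_le hb e
    nlinarith
  · have h1 := (hb.mono (b' := b + (e.weight + 1)) (by omega)).1 x
    have h2 := Expr.eval_lt (hb.mono (b' := b + 1) (by omega)) e
    rw [show b + 1 + e.weight = b + (e.weight + 1) by ring] at h2
    rw [State.setReg_reg]
    split_ifs <;> assumption
  · exact (hb.mono (b' := b + (e.weight + 1)) (by omega)).2 k i

theorem Costs.setArr (s : State) (k : ℕ) (i e : Expr) :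
    Costs (.setArr k i e) s (s.setArr k (i.eval s) (e.eval s)) (i.weight + e.weight + 1) := by
  intro b hb
  refine ⟨_, .setArr s k i e, ?_, fun x => ?_, fun k' i' => ?_⟩
  · have := Expr.cost_le hb e
    have := Expr.cost_le hb i
    nlinarith [Nat.zero_le (i.weight * e.weight)]
  · exact (hb.mono (b' := b + (i.weight + e.weight + 1)) (by omega)).1 x
  · have h1 := (hb.mono (b' := b + (i.weight + e.weight + 1)) (by omega)).2 k' i'
    have h2 := Expr.eval_lt (hb.mono (b' := b + i.weight + 1) (by omega)) e
    rw [show b + i.weight + 1 + e.weight = b + (i.weight + e.weight + 1) by ring] at h2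
    rw [State.setArr_arr_apply]
    split_ifs <;> assumption

/-- The growths add up: the second program starts from bit length `b + g`, and `g * (b + g) + g' *
(b + g + g')` is at most `(g + g') * (b + g + g')`. This additivity is the reason for measuring cost
and growth by one number. -/
theorem Costs.seq {p q : Prog} {s s' s'' : State} {g g' : ℕ} (hp : Costs p s s' g)
    (hq : Costs q s' s'' g') : Costs (.seq p q) s s'' (g + g') := by
  intro b hb
  obtain ⟨t, h1, h2, h3⟩ := hp b hb
  obtain ⟨t', h1', h2', h3'⟩ := hq _ h3
  refine ⟨_, .seq h1 h1', ?_, by rwa [← add_assoc]⟩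
  nlinarith [Nat.zero_le (g * g')]

theorem Costs.iteTrue {a b : Expr} {p q : Prog} {s s' : State} {g : ℕ}
    (h : a.eval s < b.eval s) (hp : Costs p s s' g) :
    Costs (.ite a b p q) s s' (a.weight + b.weight + 1 + g) := by
  intro c hc
  obtain ⟨t, h1, h2, h3⟩ := hp c hc
  refine ⟨_, .iteTrue h h1, ?_, h3.mono (by omega)⟩
  have := Expr.cost_le hc a
  have := Expr.cost_le hc b
  nlinarith [Nat.zero_le (a.weight * b.weight), Nat.zero_le (a.weight * g),
    Nat.zero_le (b.weight * g)]

theorem Costs.iteFalse {a b : Expr} {p q : Prog} {s s' : State} {g : ℕ}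
    (h : ¬ a.eval s < b.eval s) (hp : Costs q s s' g) :
    Costs (.ite a b p q) s s' (a.weight + b.weight + 1 + g) := by
  intro c hc
  obtain ⟨t, h1, h2, h3⟩ := hp c hc
  refine ⟨_, .iteFalse h h1, ?_, h3.mono (by omega)⟩
  have := Expr.cost_le hc a
  have := Expr.cost_le hc b
  nlinarith [Nat.zero_le (a.weight * b.weight), Nat.zero_le (a.weight * g),
    Nat.zero_le (b.weight * g)]

theorem Costs.loopDone {a b : Expr} {p : Prog} {s : State}
    (h : ¬ a.eval s < b.eval s) :
    Costs (.loop a b p) s s (a.weight + b.weight + 1) := by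
  intro c hc
  refine ⟨_, .loopDone h, ?_, hc.mono (by omega)⟩
  have := Expr.cost_le hc a
  have := Expr.cost_le hc b
  nlinarith [Nat.zero_le (a.weight * b.weight)]

theorem Costs.loopStep {a b : Expr} {p : Prog} {s s' s'' : State} {g g' : ℕ}
    (h : a.eval s < b.eval s) (hp : Costs p s s' g) (hl : Costs (.loop a b p) s' s'' g') :
    Costs (.loop a b p) s s'' (a.weight + b.weight + 1 + g + g') := by
  intro c hc
  obtain ⟨t, h1, h2, h3⟩ := hp c hc
  obtain ⟨t', h1', h2', h3'⟩ := hl _ h3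
  refine ⟨_, .loopStep h h1 h1', ?_, h3'.mono (by omega)⟩
  have := Expr.cost_le hc a
  have := Expr.cost_le hc b
  nlinarith [Nat.zero_le (a.weight * b.weight), Nat.zero_le (a.weight * g),
    Nat.zero_le (b.weight * g), Nat.zero_le (a.weight * g'), Nat.zero_le (b.weight * g'),
    Nat.zero_le (g * g')]

namespace FProg

open Polynomial in
/-- A polynomial in the length of the input that bounds the cost in the sense of `Costs`. -/
noncomputable def bound : FProg → Polynomial ℕ
  | skip => C 1
  | setReg _ e => C (e.weight + 1)
  | setArr _ i e => C (i.weight + e.weight + 1)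
  | seq p q => p.bound + q.bound
  | ite a b p q => C (a.weight + b.weight + 1) + (p.bound + q.bound)
  | forN _ e p => C 8 + X * (C (e.weight + 17) + p.bound)

/-- The bound is evaluated at a bound `m` on the content of register `0`, which no part of the
program changes. It therefore does not depend on the state or on the bit lengths reached, and a loop
multiplies the bound of its body by at most `m`. -/
theorem costs_compile (p : FProg) (hwf : p.wf = true) (h0 : p.writesReg 0 = false) (s : State)
    {m : ℕ} (hm : s.reg 0 ≤ m) : Costs p.compile s (p.run s) (p.bound.eval m) := by
  induction p generalizing s with
  | skip => simpa [bound, compile, run] using Costs.skip s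
  | setReg r e => simpa [bound, compile, run] using Costs.setReg s r e
  | setArr k i e => simpa [bound, compile, run] using Costs.setArr s k i e
  | seq p q hp hq =>
    simp only [wf, Bool.and_eq_true] at hwf
    simp only [writesReg, Bool.or_eq_false_iff] at h0
    simp only [bound, Polynomial.eval_add]
    exact (hp hwf.1 h0.1 s hm).seq (hq hwf.2 h0.2 _ (by rwa [run_reg p s 0 h0.1]))
  | ite a b p q hp hq =>
    simp only [wf, Bool.and_eq_true] at hwf
    simp only [writesReg, Bool.or_eq_false_iff] at h0
    simp only [bound, Polynomial.eval_add, Polynomial.eval_C, run]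
    split_ifs with h
    · exact (Costs.iteTrue h (hp hwf.1 h0.1 s hm)).mono (by omega)
    · exact (Costs.iteFalse h (hq hwf.2 h0.2 s hm)).mono (by omega)
  | forN r e p hp =>
    simp only [wf, Bool.and_eq_true, Bool.not_eq_true', beq_eq_false_iff_ne] at hwf
    obtain ⟨⟨⟨hwf, hr⟩, hp0⟩, hr0⟩ := hwf
    set n := s.reg 0 with hn
    set f : ℕ → State → State := fun k s' =>
      (if k < e.eval s' then run p s' else s').setReg r (k + 1) with hf
    set body : Prog := .seq (.ite (.reg r) e p.compile .skip)
      (.setReg r (.add (.reg r) (.lit 1))) with hbody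
    -- One round of the loop: `5` for the loop test, and `e.weight + p.bound.eval m + 12` for the
    -- guarded body and the increment.
    set c := e.weight + 17 + p.bound.eval m with hc
    have inv : ∀ k, (iter f k (s.setReg r 0)).reg r = k ∧
        (iter f k (s.setReg r 0)).reg 0 = n := by
      intro k
      refine iter_ind (fun k s' => s'.reg r = k ∧ s'.reg 0 = n) (by simp [hr0.symm, hn])
        fun k s' _ h => ⟨by simp [hf], ?_⟩
      simp only [hf, State.setReg_reg, if_neg hr0.symm]
      split_ifs
      exacts [(run_reg p s' 0 hp0).trans h.2, h.2]
    have step : ∀ s' k, s'.reg r = k → s'.reg 0 = n → Costs body s' (f k s')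
        (e.weight + p.bound.eval m + 12) := by
      intro s' k h1 h2
      have hif : Costs (.ite (.reg r) e p.compile .skip) s'
          (if k < e.eval s' then run p s' else s') (e.weight + p.bound.eval m + 4) := by
        split_ifs with h
        · exact (Costs.iteTrue (by simpa [Expr.eval, h1] using h)
            (hp hwf hp0 s' (by omega))).mono (by simp only [Expr.weight]; omega)
        · exact (Costs.iteFalse (by simpa [Expr.eval, h1] using h)
            (Costs.skip s')).mono (by simp only [Expr.weight]; omega)
      have hk : (if k < e.eval s' then run p s' else s').reg r = k := by
        split_ifs
        exacts [(run_reg p s' r hr).trans h1, h1]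
      have := hif.seq (Costs.setReg _ r (.add (.reg r) (.lit 1)))
      simp only [Expr.eval, hk] at this
      exact this.mono (by simp [Expr.weight])
    -- Induction on the number `j` of rounds still to be made, since `loopStep` peels off the first
    -- round while `iter` peels off the last.
    have loop : ∀ j k, k + j = n → Costs (.loop (.reg r) (.reg 0) body)
        (iter f k (s.setReg r 0)) (iter f n (s.setReg r 0)) (5 + j * c) := by
      intro j
      induction j with
      | zero =>
        rintro k hk
        obtain rfl : k = n := hk
        refine (Costs.loopDone ?_).mono (by simp [Expr.weight])
        simp [Expr.eval, inv]
      | succ j ih =>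
        intro k hk
        refine (Costs.loopStep ?_ (step _ k (inv k).1 (inv k).2)
          (ih (k + 1) (by omega))).mono ?_
        · simp only [Expr.eval, inv]; omega
        · simp only [Expr.weight, Nat.succ_mul]; omega
    have := (Costs.setReg s r (.lit 0)).seq (loop n 0 (by omega))
    refine Costs.mono this ?_
    simp only [bound, Polynomial.eval_add, Polynomial.eval_mul, Polynomial.eval_X,
      Polynomial.eval_C, Expr.weight]
    have := Nat.mul_le_mul_right c hm
    rw [← hc]
    simp only [Nat.size_zero]
    omega

end FProg

/-! ### Bit sizes of input and output -/

theorem length_le_bitSize (xs : List ℕ) : xs.length ≤ bitSize xs := by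
  induction xs with
  | nil => simp
  | cons a l ih => simp [bitSize] at *; omega

theorem bounded_initState (xs : List ℕ) : Bounded (initState xs) (bitSize xs) := by
  have key : ∀ xs : List ℕ, ∀ x ∈ xs, Nat.size x ≤ bitSize xs := by
    intro xs x hx
    have := List.single_le_sum (fun _ _ => Nat.zero_le _) _
      (List.mem_map_of_mem (f := fun x => Nat.size x + 1) hx)
    simp only [bitSize]
    omega
  refine ⟨fun r => ?_, fun k i => ?_⟩
  · simp only [initState]
    split_ifs
    · exact (length_le_bitSize xs).trans_lt Nat.lt_two_pow_self
    · positivity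
  · simp only [initState]
    split_ifs
    · by_cases hi : i < xs.length
      · rw [List.getD_eq_getElem _ _ hi]
        exact Nat.size_le.1 (key xs _ (List.getElem_mem hi))
      · rw [List.getD_eq_default _ _ (not_lt.1 hi)]; positivity
    · positivity

theorem bitSize_output_le {s : State} {b : ℕ} (h : Bounded s b) :
    bitSize s.output ≤ s.output.length * (b + 1) := by
  have : ∀ xs : List ℕ, (∀ x ∈ xs, Nat.size x ≤ b) → bitSize xs ≤ xs.length * (b + 1) := by
    intro xs
    induction xs with
    | nil => simp [bitSize]
    | cons a l ih =>
      intro hx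
      have h1 := hx a (by simp)
      have h2 := ih fun x hx' => hx x (by simp [hx'])
      simp only [bitSize, List.map_cons, List.sum_cons, List.length_cons, Nat.succ_mul] at *
      omega
  refine this _ fun x hx => ?_
  simp only [State.output, List.mem_map] at hx
  obtain ⟨i, -, rfl⟩ := hx
  exact Nat.size_le.2 (h.2 1 i)

/-- A program with bounded loops, followed by an assignment of the length of the output, runs in
polynomial time as soon as the length of its output is polynomially bounded. -/
theorem exists_polynomial_time (p : FProg) (hwf : p.wf = true) (h0 : p.writesReg 0 = false)
    (x : ℕ) (q : Polynomial ℕ) :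
    ∃ (P : Prog) (pol : Polynomial ℕ), ∀ xs : List ℕ,
      ((p.run (initState xs)).setReg 0 ((p.run (initState xs)).reg x)).output.length
        ≤ q.eval (bitSize xs) →
      ∃ t, Exec P (initState xs) t
          ((p.run (initState xs)).setReg 0 ((p.run (initState xs)).reg x)) ∧
        t + bitSize ((p.run (initState xs)).setReg 0 ((p.run (initState xs)).reg x)).output
          ≤ pol.eval (bitSize xs) := by
  -- The total growth is `p.bound + 3`, where `3` pays for the final register assignment. The first
  -- product bounds the cost from an initial bit length `X`; the second multiplies the length of the
  -- output by the bit length of its words, with one separator each.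
  refine ⟨.seq p.compile (.setReg 0 (.reg x)),
    (p.bound + 3) * (.X + (p.bound + 3)) + q * (.X + (p.bound + 3) + 1), fun xs hq => ?_⟩
  have h1 := (p.costs_compile hwf h0 (initState xs) (m := bitSize xs)
    (by simpa [initState] using length_le_bitSize xs)).seq
    (Costs.setReg _ 0 (.reg x))
  obtain ⟨t, ht, hle, hb⟩ := h1 _ (bounded_initState xs)
  refine ⟨t, ht, ?_⟩
  have h2 := bitSize_output_le hb
  have h3 := h2.trans (Nat.mul_le_mul_right _ hq)
  simp only [Expr.weight, Polynomial.eval_add, Polynomial.eval_mul, Polynomial.eval_X,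
    Polynomial.eval_one, Polynomial.eval_ofNat, Expr.eval] at *
  exact Nat.add_le_add hle h3

end RAM

namespace ReplicaCounting

open Finset RAM

/-! ### Flow of requests in a topologically sorted tree

The nodes are `0, …, N - 1`, the root is `0`, and `par v ≤ v` is the parent of `v`. The nodes are
visited in the order `N - 1, …, 0`. -/

/-- Node `v` serves up to `u v` of the requests `g v` waiting there and passes the others on to
its parent. -/
def flowStep (par u g : ℕ → ℕ) (v : ℕ) : ℕ → ℕ := fun j =>
  (if j = v then 0 else g j) + (if j = par v then g v - u v else 0)

/-- The requests waiting at the nodes after `t` nodes have been visited. -/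
def flow (par u : ℕ → ℕ) (N : ℕ) (g : ℕ → ℕ) : ℕ → ℕ → ℕ
  | 0 => g
  | t + 1 => flowStep par u (flow par u N g t) (N - (t + 1))

theorem flow_congr {par u u' : ℕ → ℕ} {N : ℕ} {g : ℕ → ℕ} {t : ℕ} (ht : t ≤ N)
    (h : ∀ v, N - t ≤ v → v < N → u v = u' v) : flow par u N g t = flow par u' N g t := by
  induction t with
  | zero => rfl
  | succ t ih =>
    have h1 := ih (by omega) fun v hv => h v (by omega)
    have h2 := h (N - (t + 1)) le_rfl (by omega)
    simp only [flow, h1]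
    funext j
    simp [flowStep, h2]

/-- Each step is monotone in the waiting requests and antitone in the capacity, so extra capacity
can only reduce what waits anywhere. -/
theorem flow_anti {par u u' : ℕ → ℕ} {N : ℕ} {g : ℕ → ℕ} (h : ∀ v, u v ≤ u' v) (t j : ℕ) :
    flow par u' N g t j ≤ flow par u N g t j := by
  induction t generalizing j with
  | zero => exact le_rfl
  | succ t ih =>
    have h1 := ih j
    have h2 := ih (N - (t + 1))
    have h3 := h (N - (t + 1))
    simp only [flow, flowStep]
    split_ifs <;> omega

/-! ### The dynamic program -/

/-- The least number of requests leaving `v` upwards with `k` replicas at or below `v`, in terms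
of the table `G` for the requests arriving at the nodes. -/
def leaving (w : ℕ → ℕ) (G : ℕ → ℕ → ℕ) (v k : ℕ) : ℕ :=
  if k = 0 then G v 0 else min (G v k) (G v (k - 1) - w v)

/-- The minimum of `A (k - i) + F i` over `i < j` (and `i = 0`). -/
def runMin (A F : ℕ → ℕ) (k : ℕ) : ℕ → ℕ
  | 0 => A k + F 0
  | j + 1 => min (runMin A F k j) (A (k - j) + F j)

/-- The infimal convolution. -/
def infConv (A F : ℕ → ℕ) (k : ℕ) : ℕ := runMin A F k (k + 1)

theorem infConv_le {A F : ℕ → ℕ} {k j : ℕ} (h : j ≤ k) : infConv A F k ≤ A (k - j) + F j := by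
  have : ∀ m, j < m → runMin A F k m ≤ A (k - j) + F j := by
    intro m hm
    induction m with
    | zero => omega
    | succ m ih =>
      rcases Nat.lt_succ_iff_lt_or_eq.1 hm with hm | rfl
      · exact (min_le_left _ _).trans (ih hm)
      · exact min_le_right _ _
  exact this _ (by omega)

theorem exists_infConv_eq (A F : ℕ → ℕ) (k : ℕ) : ∃ j ≤ k, infConv A F k = A (k - j) + F j := by
  have : ∀ m ≤ k + 1, ∃ j ≤ k, runMin A F k m = A (k - j) + F j := by
    intro m hm
    induction m with
    | zero => exact ⟨0, by omega, rfl⟩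
    | succ m ih =>
      obtain ⟨j, hj, h⟩ := ih (by omega)
      rcases min_choice (runMin A F k m) (A (k - m) + F m) with h' | h'
      · exact ⟨j, hj, h'.trans h⟩
      · exact ⟨m, by omega, h'⟩
  exact this _ le_rfl

/-- The visit of node `v` in the dynamic program. -/
def tableStep (par w : ℕ → ℕ) (G : ℕ → ℕ → ℕ) (v : ℕ) : ℕ → ℕ → ℕ :=
  Function.update (Function.update G v fun _ => 0) (par v)
    (infConv (Function.update G v (fun _ => 0) (par v)) (leaving w G v))

/-- The table of the dynamic program after `t` nodes have been visited: the least number of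
requests that wait at a node if `k` replicas have been placed on visited nodes below it. -/
def table (par w : ℕ → ℕ) (N : ℕ) (g : ℕ → ℕ) : ℕ → ℕ → ℕ → ℕ
  | 0 => fun v _ => g v
  | t + 1 => tableStep par w (table par w N g t) (N - (t + 1))

theorem table_congr {par w w' : ℕ → ℕ} {N : ℕ} {g : ℕ → ℕ} {t : ℕ} (ht : t ≤ N)
    (h : ∀ v < N, w v = w' v) : table par w N g t = table par w' N g t := by
  induction t with
  | zero => rfl
  | succ t ih =>
    have h2 := h (N - (t + 1)) (by omega)
    have h3 : ∀ G, leaving w G (N - (t + 1)) = leaving w' G (N - (t + 1)) := fun G => by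
      funext k; simp only [leaving, h2]
    simp only [table, ih (by omega), tableStep, h3]

/-- The capacities `w`, restricted to the set `R` of replicas. -/
def mask (w : ℕ → ℕ) (R : Finset ℕ) (v : ℕ) : ℕ := if v ∈ R then w v else 0

theorem sum_range_update {N x : ℕ} (hx : x < N) (b : ℕ → ℕ) (y : ℕ) :
    ∑ v ∈ range N, Function.update b x y v + b x = ∑ v ∈ range N, b v + y := by
  rw [sum_update_of_mem (mem_range.2 hx), sdiff_singleton_eq_erase,
    ← add_sum_erase _ b (mem_range.2 hx)]
  ring

/-- Every entry of the table is attained. The budgets `b` of all nodes are handled simultaneously,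
because one set of replicas has to serve all the pending subtrees at once. -/
theorem exists_flow_le_table {par w : ℕ → ℕ} {N : ℕ} {g : ℕ → ℕ} (hpar : ∀ v < N, par v ≤ v)
    {t : ℕ} (ht : t ≤ N) (b : ℕ → ℕ) :
    ∃ R ⊆ Ico (N - t) N, R.card ≤ ∑ v ∈ range N, b v ∧
      ∀ v, flow par (mask w R) N g t v ≤ table par w N g t v (b v) := by
  induction t generalizing b with
  | zero => exact ⟨∅, by simp, by simp, fun v => le_rfl⟩
  | succ t ih =>
    set v := N - (t + 1) with hv
    have hvN : v < N := by omega
    have hp := hpar v hvN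
    set p := par v with hpv
    set G := table par w N g t with hG
    -- The minimum in the convolution is attained where `j` of the `b p` replicas go to the subtree
    -- of `v`. Of these, `j'` lie strictly below `v`, and `used` records whether `v` itself is the
    -- remaining one.
    obtain ⟨j, hj, hconv⟩ := exists_infConv_eq (Function.update G v (fun _ => 0) p)
      (leaving w G v) (b p)
    obtain ⟨used, j', hj', hF⟩ : ∃ used j', j' + (if used then 1 else 0) = j ∧
        leaving w G v j = G v j' - if used = true then w v else 0 := by
      by_cases h0 : j = 0
      · exact ⟨false, 0, by simp [h0], by simp [leaving, h0]⟩
      · rcases min_choice (G v j) (G v (j - 1) - w v) with h | h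
        · exact ⟨false, j, by simp, by simp [leaving, h0, h]⟩
        · exact ⟨true, j - 1, by simp; omega, by simp only [leaving, if_neg h0, h]; simp⟩
    -- The budgets before the visit. At the root, where `p = v`, the outer update prevails and the
    -- `b p - j` unspent replicas are simply dropped.
    set b' := Function.update (Function.update b p (b p - j)) v j' with hb'
    obtain ⟨R, hR, hcard, hle⟩ := ih (by omega) b'
    have hsum : ∑ x ∈ range N, b' x + (if used then 1 else 0) ≤ ∑ x ∈ range N, b x := by
      have h1 := sum_range_update (N := N) (x := p) (by omega) b (b p - j)
      have h2 := sum_range_update (N := N) (x := v) (by omega) (Function.update b p (b p - j)) j'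
      rw [← hb'] at h2
      rw [Function.update_apply] at h2
      split_ifs at h2 with hc
      · split_ifs at * <;> omega
      · split_ifs at * <;> omega
    have hvR : v ∉ R := fun h => by have := mem_Ico.1 (hR h); omega
    refine ⟨if used then insert v R else R, ?_, ?_, ?_⟩
    · have : R ⊆ Ico v N := hR.trans (Ico_subset_Ico_left (by omega))
      split_ifs
      · exact insert_subset (mem_Ico.2 ⟨le_rfl, hvN⟩) this
      · exact this
    · cases used
      · simp at *; omega
      · simp [hvR] at *; omega
    · set R' := if used then insert v R else R with hR'
      have hflow : flow par (mask w R') N g t = flow par (mask w R) N g t := by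
        refine flow_congr (by omega) fun x hx _ => ?_
        have : x ≠ v := by omega
        rw [hR']
        split_ifs <;> simp [mask, this]
      have hmask : mask w R' v = if used = true then w v else 0 := by
        rw [hR']; cases used <;> simp [mask, hvR]
      intro x
      simp only [flow, table]
      rw [hflow, ← hv, ← hG]
      simp only [flowStep, tableStep, ← hpv, hmask]
      have hlv := hle v
      have hlx := hle x
      have hb'v : b' v = j' := by simp [hb']
      rw [hb'v] at hlv
      by_cases hxp : x = p
      · subst hxp
        rw [Function.update_self, hconv, hF]
        by_cases hxv : p = v
        · rw [hxv] at *
          simp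
          omega
        · have : b' p = b p - j := by simp [hb', hxv]
          rw [this] at hlx
          simp only [hxv, if_false, if_true, Function.update_of_ne (Ne.intro hxv)]
          omega
      · rw [Function.update_of_ne hxp]
        simp only [hxp, if_false, add_zero]
        by_cases hxv : x = v
        · simp [hxv]
        · have : b' x = b x := by simp [hb', hxv, hxp]
          rw [this] at hlx
          simpa [hxv] using hlx

/-- The table is a lower bound for every set: charge each replica to the unvisited ancestor at which
its subtree has been merged (finally the root). These charges are the budgets `b`, and they never
exceed the number of visited replicas. -/
theorem exists_table_le_flow {par w : ℕ → ℕ} {N : ℕ} {g : ℕ → ℕ} (hpar : ∀ v < N, par v ≤ v)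
    (R : Finset ℕ) {t : ℕ} (ht : t ≤ N) :
    ∃ b : ℕ → ℕ, ∑ v ∈ range N, b v ≤ ∑ i ∈ range t, (if N - (i + 1) ∈ R then 1 else 0) ∧
      ∀ v, table par w N g t v (b v) ≤ flow par (mask w R) N g t v := by
  induction t with
  | zero => exact ⟨fun _ => 0, by simp, fun v => le_rfl⟩
  | succ t ih =>
    obtain ⟨b, hsum, hle⟩ := ih (by omega)
    set v := N - (t + 1) with hv
    have hvN : v < N := by omega
    have hp := hpar v hvN
    set p := par v with hpv
    set G := table par w N g t with hG
    set e := if v ∈ R then 1 else 0 with he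
    -- The charge of `v`, plus one if `v` is a replica, moves to the parent. Clearing `v` first
    -- prevents double counting at the root.
    set b1 := Function.update b v 0 with hb1
    set b' := Function.update b1 p (b1 p + (b v + e)) with hb'
    refine ⟨b', ?_, fun x => ?_⟩
    · have h1 := sum_range_update (x := v) hvN b 0
      have h2 := sum_range_update (N := N) (x := p) (by omega) b1 (b1 p + (b v + e))
      rw [← hb1] at h1
      rw [← hb'] at h2
      rw [sum_range_succ, ← hv, ← he]
      omega
    · simp only [flow, table]
      rw [← hv, ← hG]
      simp only [flowStep, tableStep, ← hpv]
      have hF : leaving w G v (b v + e) ≤ flow par (mask w R) N g t v - mask w R v := by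
        have h1 := hle v
        by_cases hvR : v ∈ R
        · simp only [he, hvR, if_true, mask, leaving]
          simp
          omega
        · simp only [he, hvR, if_false, mask, leaving]
          split_ifs with h0
          · simp only [add_zero] at h0; rw [h0] at h1; simpa using h1
          · simp; omega
      by_cases hxp : x = p
      · subst hxp
        have hc : infConv (Function.update G v (fun _ => 0) p) (leaving w G v) (b' p) ≤ _ :=
          infConv_le (j := b v + e) (by simp [hb'])
        rw [Function.update_self]
        refine hc.trans ?_
        have : b' p - (b v + e) = b1 p := by simp [hb']
        rw [this, if_pos rfl]
        refine Nat.add_le_add ?_ hF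
        by_cases hxv : p = v
        · simp [hxv]
        · simp only [hxv, if_false, Function.update_of_ne (Ne.intro hxv), hb1]
          exact hle p
      · rw [Function.update_of_ne hxp]
        simp only [hxp, if_false, add_zero]
        by_cases hxv : x = v
        · simp [hxv]
        · have : b' x = b x := by simp [hb', hb1, hxv, hxp]
          rw [this]
          simpa [hxv] using hle x

/-- With capacities `w`, all requests can be served by at most `k` replicas. -/
def Feasible (par w : ℕ → ℕ) (N : ℕ) (g : ℕ → ℕ) (k : ℕ) : Prop :=
  ∃ R ⊆ range N, R.card ≤ k ∧ flow par (mask w R) N g N 0 = 0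

theorem feasible_of_table {par w : ℕ → ℕ} {N : ℕ} {g : ℕ → ℕ} (hpar : ∀ v < N, par v ≤ v)
    (hN : 0 < N) {k : ℕ} (h : table par w N g N 0 k = 0) : Feasible par w N g k := by
  obtain ⟨R, hR, hcard, hle⟩ := exists_flow_le_table (w := w) (g := g) hpar le_rfl (Pi.single 0 k)
  refine ⟨R, fun x hx => ?_, ?_, ?_⟩
  · have := mem_Ico.1 (hR hx); exact mem_range.2 this.2
  · rwa [sum_pi_single', if_pos (mem_range.2 hN)] at hcard
  · have := hle 0
    rw [Pi.single_eq_same, h] at this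
    omega

/-- The zero is found at some index at most `k`, so monotonicity of the rows in the budget is never
needed. The bound by `N` guarantees that it lies in the part of the row that the machine stores. -/
theorem exists_table_of_feasible {par w : ℕ → ℕ} {N : ℕ} {g : ℕ → ℕ}
    (hpar : ∀ v < N, par v ≤ v) (hN : 0 < N) {k : ℕ} (h : Feasible par w N g k) :
    ∃ k' ≤ k, k' ≤ N ∧ table par w N g N 0 k' = 0 := by
  obtain ⟨R, hR, hcard, hflow⟩ := h
  obtain ⟨b, hsum, hle⟩ := exists_table_le_flow (w := w) (g := g) hpar R le_rfl
  have h1 : ∑ i ∈ range N, (if N - (i + 1) ∈ R then 1 else 0) = R.card := by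
    have := sum_range_reflect (fun i => if i ∈ R then 1 else 0) N
    have h2 : ∀ i, N - 1 - i = N - (i + 1) := fun i => by omega
    simp only [h2] at this
    rw [this, sum_ite_mem, inter_eq_right.2 hR]
    simp
  have h2 := single_le_sum (f := b) (fun _ _ => Nat.zero_le _) (mem_range.2 hN)
  have h3 := card_le_card hR
  rw [card_range] at h3
  refine ⟨b 0, by omega, by omega, ?_⟩
  have := hle 0
  omega

theorem Feasible.mono {par w w' : ℕ → ℕ} {N : ℕ} {g : ℕ → ℕ} {k k' : ℕ}
    (h : Feasible par w N g k) (hw : ∀ v, w v ≤ w' v) (hk : k ≤ k') :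
    Feasible par w' N g k' := by
  obtain ⟨R, hR, hcard, hflow⟩ := h
  refine ⟨R, hR, hcard.trans hk, Nat.le_zero.1 ((flow_anti (fun v => ?_) N 0).trans hflow.le)⟩
  simp only [mask]
  split_ifs
  exacts [hw v, le_rfl]

/-! ### Thinning out the set of replicas -/

/-- The capacities left after `q` attempts to remove the replicas `0, …, q - 1` in turn, where a
replica is removed if `K` replicas still suffice. -/
def thin (par : ℕ → ℕ) (W N : ℕ) (g : ℕ → ℕ) (K : ℕ) : ℕ → ℕ → ℕ
  | 0 => fun _ => W
  | q + 1 => Function.update (thin par W N g K q) q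
      (if table par (Function.update (thin par W N g K q) q 0) N g N 0 K = 0 then 0 else W)

theorem thin_of_le {par : ℕ → ℕ} {W N : ℕ} {g : ℕ → ℕ} {K q v : ℕ} (h : q ≤ v) :
    thin par W N g K q v = W := by
  induction q with
  | zero => rfl
  | succ q ih =>
    rw [thin, Function.update_of_ne (by omega), ih (by omega)]

/-- A capacity is only ever lowered, since before its own attempt a node still has full capacity
`W`. -/
theorem thin_le_thin {par : ℕ → ℕ} {W N : ℕ} {g : ℕ → ℕ} {K q q' : ℕ} (h : q ≤ q') (v : ℕ) :
    thin par W N g K q' v ≤ thin par W N g K q v := by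
  induction q', h using Nat.le_induction with
  | base => exact le_rfl
  | succ q' _ ih =>
    refine le_trans ?_ ih
    rw [thin, Function.update_apply]
    split_ifs with h1 h2
    · exact Nat.zero_le _
    · rw [h1, thin_of_le le_rfl]
    · exact le_rfl

/-- At the end `K` replicas `R` still suffice, and disabling any further node would make `K`
insufficient. A node outside `R` could be disabled without affecting `R`, so all enabled nodes lie
in `R`. -/
theorem thin_spec {par : ℕ → ℕ} {W N : ℕ} {g : ℕ → ℕ} {K : ℕ} (hpar : ∀ v < N, par v ≤ v)
    (hN : 0 < N) (hK : table par (fun _ => W) N g N 0 K = 0)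
    (hmin : ∀ k < K, table par (fun _ => W) N g N 0 k ≠ 0) :
    flow par (thin par W N g K N) N g N 0 = 0 ∧
      #{v ∈ range N | thin par W N g K N v ≠ 0} ≤ K := by
  have hle : ∀ q v, thin par W N g K q v ≤ W := fun q v => thin_le_thin (Nat.zero_le q) v
  have hfeas : ∀ q, Feasible par (thin par W N g K q) N g K := by
    intro q
    induction q with
    | zero => exact feasible_of_table hpar hN hK
    | succ q ih =>
      rw [thin]
      split_ifs with h
      · exact feasible_of_table hpar hN h
      · have hq : thin par W N g K q q = W := thin_of_le le_rfl
        rwa [Function.update_eq_self_iff.2 hq.symm]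
  have hnot : ∀ v < N, thin par W N g K N v ≠ 0 →
      ¬ Feasible par (Function.update (thin par W N g K N) v 0) N g K := by
    intro v hv h0 hf
    have hmono : ∀ x, Function.update (thin par W N g K N) v 0 x ≤
        Function.update (thin par W N g K v) v 0 x := by
      intro x
      simp only [Function.update_apply]
      split_ifs
      exacts [le_rfl, thin_le_thin hv.le x]
    have hf' := hf.mono hmono le_rfl
    -- Had the attempt at `v` succeeded, the capacity of `v` would have become zero and stayed zero.
    have hne : table par (Function.update (thin par W N g K v) v 0) N g N 0 K ≠ 0 := by
      intro h
      have := thin_le_thin (par := par) (W := W) (N := N) (g := g) (K := K)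
        (Nat.succ_le_of_lt hv) v
      rw [thin, if_pos h, Function.update_self] at this
      omega
    obtain ⟨k', hk', -, h1⟩ := exists_table_of_feasible hpar hN hf'
    have hW : Feasible par (fun _ => W) N g k' := (feasible_of_table hpar hN h1).mono
      (fun x => by
        rw [Function.update_apply]
        split_ifs
        exacts [Nat.zero_le _, hle v x]) le_rfl
    obtain ⟨k'', hk'', -, h2⟩ := exists_table_of_feasible hpar hN hW
    -- Both `k''` and `k'` are squeezed: `k'' ≤ k' ≤ K`, and no index below `K` is a zero at full
    -- capacity. So the zero found after disabling `v` is at `K` itself, which is the entry that the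
    -- attempt tested.
    have : k'' = K := by
      by_contra hc
      exact hmin k'' (by omega) h2
    obtain rfl : k' = K := by omega
    exact hne h1
  obtain ⟨R, hR, hcard, hflow⟩ := hfeas N
  refine ⟨?_, (card_le_card fun v hv => ?_).trans hcard⟩
  · refine Nat.le_zero.1 ((flow_anti (fun v => ?_) N 0).trans hflow.le)
    simp only [mask]
    split_ifs
    exacts [le_rfl, Nat.zero_le _]
  · rw [mem_filter, mem_range] at hv
    by_contra hvR
    refine hnot v hv.1 hv.2 ⟨R, hR, hcard, ?_⟩
    refine (congrFun (flow_congr le_rfl fun x _ _ => ?_) 0).trans hflow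
    simp only [mask, Function.update_apply]
    split_ifs with h1 h2
    · exact absurd (h2 ▸ h1) hvR
    · rfl
    · rfl

/-! ### Assigning the requests of the clients -/

/-- The number of requests waiting at `v` that belong to the clients `0, …, i - 1`, if the `rem i`
remaining requests of client `i` wait at node `cur i`. -/
def waiting (cur rem : ℕ → ℕ) (v i : ℕ) : ℕ :=
  ∑ i' ∈ range i, if cur i' = v then rem i' else 0

/-- The number of requests of client `i` served by node `v` of capacity `c`. -/
def served (cur rem : ℕ → ℕ) (c v i : ℕ) : ℕ :=
  if cur i = v then min (rem i) (c - waiting cur rem v i) else 0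

/-- Clients are served in order of index, each from the capacity left by its predecessors, so the
total is capped exactly at `c`. -/
theorem sum_served (cur rem : ℕ → ℕ) (c v m : ℕ) :
    ∑ i ∈ range m, served cur rem c v i = min (waiting cur rem v m) c := by
  induction m with
  | zero => simp [waiting]
  | succ m ih =>
    rw [sum_range_succ, ih]
    simp only [waiting, sum_range_succ, served]
    split_ifs <;> omega

/-- The requests that move on are counted by the same truncated difference as in `flowStep`; this
makes clientwise bookkeeping agree with the aggregate flow. -/
theorem sum_remaining (cur rem : ℕ → ℕ) (c v m : ℕ) :
    ∑ i ∈ range m, (if cur i = v then rem i - served cur rem c v i else 0) =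
      waiting cur rem v m - c := by
  have h := sum_served cur rem c v m
  have h2 : waiting cur rem v m = ∑ i ∈ range m, (if cur i = v then rem i - served cur rem c v i
      else 0) + ∑ i ∈ range m, served cur rem c v i := by
    rw [waiting, ← sum_add_distrib]
    refine sum_congr rfl fun i _ => ?_
    simp only [served]
    split_ifs <;> omega
  omega

/-- The node where the remaining requests of a client wait after `t` visits. -/
def curAt (par cp : ℕ → ℕ) (N : ℕ) : ℕ → ℕ → ℕ
  | 0 => cp
  | t + 1 => fun i =>
      if curAt par cp N t i = N - (t + 1) then par (N - (t + 1)) else curAt par cp N t i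

/-- The number of remaining requests of a client after `t` visits. -/
def remAt (par cp w : ℕ → ℕ) (N : ℕ) (r : ℕ → ℕ) : ℕ → ℕ → ℕ
  | 0 => r
  | t + 1 => fun i => remAt par cp w N r t i - served (curAt par cp N t) (remAt par cp w N r t)
      (w (N - (t + 1))) (N - (t + 1)) i

/-- The number of requests of client `i` served by node `v`. -/
def assign (par cp w : ℕ → ℕ) (N : ℕ) (r : ℕ → ℕ) (i v : ℕ) : ℕ :=
  served (curAt par cp N (N - (v + 1))) (remAt par cp w N r (N - (v + 1))) (w v) v i

theorem curAt_lt {par cp : ℕ → ℕ} {N : ℕ} (hpar : ∀ v < N, par v ≤ v)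
    (hpar' : ∀ v < N, 0 < v → par v < v) {i : ℕ} (hi : cp i < N) (t : ℕ) (ht : t ≤ N) :
    curAt par cp N t i < N - t ∨ curAt par cp N t i = 0 := by
  induction t with
  | zero => exact .inl hi
  | succ t ih =>
    have := ih (by omega)
    have h1 := hpar (N - (t + 1)) (by omega)
    have h2 := hpar' (N - (t + 1)) (by omega)
    simp only [curAt]
    split_ifs <;> omega

theorem exists_curAt_eq (par cp : ℕ → ℕ) (N i t : ℕ) :
    ∃ k, curAt par cp N t i = par^[k] (cp i) := by
  induction t with
  | zero => exact ⟨0, rfl⟩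
  | succ t ih =>
    obtain ⟨k, hk⟩ := ih
    simp only [curAt]
    split_ifs with h
    · exact ⟨k + 1, by rw [Function.iterate_succ_apply', ← hk, h]⟩
    · exact ⟨k, hk⟩

/-- Tracking individual clients refines the flow: all remaining requests of a client wait at a
single node, and summing over the clients at a node gives its flow value. -/
theorem waiting_curAt {par cp w : ℕ → ℕ} {N M : ℕ} {r : ℕ → ℕ} (t j : ℕ) :
    waiting (curAt par cp N t) (remAt par cp w N r t) j M =
      flow par w N (fun v => waiting cp r v M) t j := by
  induction t generalizing j with
  | zero => rfl
  | succ t ih =>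
    simp only [flow, flowStep, ← ih]
    rw [← sum_remaining]
    simp only [waiting]
    have e1 : ∀ (P : Prop) [Decidable P] (f : ℕ → ℕ), (if P then 0 else ∑ i ∈ range M, f i) =
        ∑ i ∈ range M, if P then 0 else f i := fun P _ f => by split_ifs <;> simp
    have e2 : ∀ (P : Prop) [Decidable P] (f : ℕ → ℕ), (if P then ∑ i ∈ range M, f i else 0) =
        ∑ i ∈ range M, if P then f i else 0 := fun P _ f => by split_ifs <;> simp
    rw [e1, e2, ← sum_add_distrib]
    refine sum_congr rfl fun i _ => ?_
    simp only [curAt, remAt]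
    by_cases h : curAt par cp N t i = N - (t + 1)
    · simp only [h, if_true]
      by_cases h1 : par (N - (t + 1)) = j
      · subst h1
        by_cases h2 : par (N - (t + 1)) = N - (t + 1)
        · simp [h2]
        · simp [h2, Ne.symm h2]
      · simp only [h1, Ne.symm h1, if_false, add_zero]
        by_cases h2 : j = N - (t + 1)
        · simp [h2]
        · simp [h2, Ne.symm h2]
    · have : served (curAt par cp N t) (remAt par cp w N r t)
          (w (N - (t + 1))) (N - (t + 1)) i = 0 := by simp [served, h]
      simp only [h, if_false, this, Nat.sub_zero]
      by_cases h2 : j = N - (t + 1)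
      · subst h2
        simp [h]
      · simp [h2]

theorem sum_assign {par cp w : ℕ → ℕ} {N M : ℕ} {r : ℕ → ℕ} (hpar : ∀ v < N, par v ≤ v)
    (hpar' : ∀ v < N, 0 < v → par v < v) (hcp : ∀ i < M, cp i < N)
    (hflow : flow par w N (fun v => waiting cp r v M) N 0 = 0) {i : ℕ} (hi : i < M) :
    ∑ v ∈ range N, assign par cp w N r i v = r i := by
  have h1 : ∀ t, ∑ t' ∈ range t, served (curAt par cp N t') (remAt par cp w N r t')
      (w (N - (t' + 1))) (N - (t' + 1)) i + remAt par cp w N r t i = r i := by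
    intro t
    induction t with
    | zero => simp [remAt]
    | succ t ih =>
      rw [sum_range_succ]
      have : served (curAt par cp N t) (remAt par cp w N r t)
          (w (N - (t + 1))) (N - (t + 1)) i ≤ remAt par cp w N r t i := by
        simp only [served]; split_ifs <;> omega
      simp only [remAt]
      omega
  -- After all visits every client has reached the root, and nothing waits there.
  have h2 : remAt par cp w N r N i = 0 := by
    rw [← waiting_curAt, waiting, sum_eq_zero_iff] at hflow
    have := hflow i (mem_range.2 hi)
    have hc := curAt_lt hpar hpar' (hcp i hi) N le_rfl
    rwa [if_pos (by omega)] at this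
  have h3 := h1 N
  rw [h2, add_zero] at h3
  rw [← h3, ← sum_range_reflect]
  refine sum_congr rfl fun t ht => ?_
  have ht := mem_range.1 ht
  have e1 : N - 1 - t = N - (t + 1) := by omega
  have e2 : N - (N - (t + 1) + 1) = t := by omega
  rw [assign, e1, e2]

theorem sum_assign_le (par cp w : ℕ → ℕ) (N M : ℕ) (r : ℕ → ℕ) (v : ℕ) :
    ∑ i ∈ range M, assign par cp w N r i v ≤ w v := by
  simp only [assign, sum_served]
  exact min_le_right _ _

theorem exists_iterate_of_assign_ne_zero {par cp w : ℕ → ℕ} {N : ℕ} {r : ℕ → ℕ} {i v : ℕ}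
    (h : assign par cp w N r i v ≠ 0) : ∃ k, par^[k] (cp i) = v := by
  obtain ⟨k, hk⟩ := exists_curAt_eq par cp N i (N - (v + 1))
  refine ⟨k, ?_⟩
  by_contra hc
  rw [← hk] at hc
  exact h (by simp [assign, served, hc])

/-- If some assignment respects the capacities `u`, then the flow with these capacities leaves no
request unserved. -/
theorem flow_eq_zero_of_assignment {par cp u : ℕ → ℕ} {N M : ℕ} {r : ℕ → ℕ}
    (hpar : ∀ v < N, par v ≤ v) (hpar' : ∀ v < N, 0 < v → par v < v)
    (hcp : ∀ i < M, cp i < N) (y : ℕ → ℕ → ℕ)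
    (hpath : ∀ i < M, ∀ v < N, y i v ≠ 0 → ∃ k, par^[k] (cp i) = v)
    (hserved : ∀ i < M, ∑ v ∈ range N, y i v = r i)
    (hcap : ∀ v < N, ∑ i ∈ range M, y i v ≤ u v) (j : ℕ) :
    flow par u N (fun v => waiting cp r v M) N j = 0 := by
  have hit : ∀ k x, x < N → par^[k] x ≤ x ∧ par^[k] x < N := by
    intro k
    induction k with
    | zero => intro x hx; exact ⟨le_rfl, hx⟩
    | succ k ih =>
      intro x hx
      have h1 := hpar x hx
      have := ih (par x) (by omega)
      rw [Function.iterate_succ_apply]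
      omega
  -- Every unvisited node used by `y` for client `i` is still reachable upwards from where that
  -- client waits now, because a client leaves only nodes that have been visited.
  have hcur : ∀ t ≤ N, ∀ i < M, ∀ v < N - t, y i v ≠ 0 →
      ∃ k, par^[k] (curAt par cp N t i) = v := by
    intro t
    induction t with
    | zero => intro _ i hi v hv; exact hpath i hi v hv
    | succ t ih =>
      intro ht i hi v hv h0
      obtain ⟨k, hk⟩ := ih (by omega) i hi v (by omega) h0
      simp only [curAt]
      split_ifs with h
      · cases k with
        | zero => simp only [Function.iterate_zero, id] at hk; omega
        | succ k => exact ⟨k, by rwa [← h]⟩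
      · exact ⟨k, hk⟩
  -- The invariant that the greedy flow is never behind `y`: what waits at `j` is at most what `y`
  -- leaves to unvisited nodes among the clients now at `j`.
  have key : ∀ t ≤ N, ∀ j, flow par u N (fun v => waiting cp r v M) t j ≤
      ∑ i ∈ range M, if curAt par cp N t i = j then ∑ s ∈ range (N - t), y i s else 0 := by
    intro t
    induction t with
    | zero =>
      intro _ j
      simp only [flow, waiting]
      refine sum_le_sum fun i hi => ?_
      rw [Nat.sub_zero, hserved i (mem_range.1 hi), curAt]
    | succ t ih =>
      intro ht j
      have ih := ih (by omega)
      set v := N - (t + 1) with hv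
      have hvt : N - t = v + 1 := by omega
      simp only [hvt, sum_range_succ] at ih
      -- Positions do not increase along the path to the root, and `v` is the largest unvisited
      -- position, so only clients already waiting at `v` can use it.
      have hy : ∀ i < M, curAt par cp N t i ≠ v → y i v = 0 := by
        intro i hi hne
        by_contra h0
        obtain ⟨k, hk⟩ := hcur t (by omega) i hi v (by omega) h0
        have h1 := curAt_lt hpar hpar' (hcp i hi) t (by omega)
        have h2 := hit k (curAt par cp N t i) (by omega)
        omega
      have hA : flow par u N (fun v => waiting cp r v M) t v - u v ≤
          ∑ i ∈ range M, if curAt par cp N t i = v then ∑ s ∈ range v, y i s else 0 := by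
        have h1 := ih v
        have h2 := hcap v (by omega)
        have h3 : ∑ i ∈ range M, (if curAt par cp N t i = v then ∑ s ∈ range v, y i s + y i v
            else 0) ≤ ∑ i ∈ range M, (if curAt par cp N t i = v then ∑ s ∈ range v, y i s
            else 0) + ∑ i ∈ range M, y i v := by
          rw [← sum_add_distrib]
          refine sum_le_sum fun i _ => ?_
          split_ifs <;> omega
        omega
      have hB : j ≠ v → flow par u N (fun v => waiting cp r v M) t j ≤
          ∑ i ∈ range M, if curAt par cp N t i = j then ∑ s ∈ range v, y i s else 0 := by
        intro hj
        refine (ih j).trans (sum_le_sum fun i hi => ?_)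
        split_ifs with h
        · rw [hy i (mem_range.1 hi) (by omega)]; simp
        · exact le_rfl
      simp only [flow, flowStep, ← hv]
      have hcs : ∀ i, curAt par cp N (t + 1) i =
        if curAt par cp N t i = v then par v else curAt par cp N t i := fun _ => rfl
      simp only [hcs]
      -- The requests staying at `j` and those arriving from `v` are written as sums over clients
      -- with exclusive conditions, so that the two bounds can be added term by term.
      have h0 : (if j = v then 0 else flow par u N (fun v => waiting cp r v M) t j) ≤
          ∑ i ∈ range M, if curAt par cp N t i = j ∧ j ≠ v then ∑ s ∈ range v, y i s else 0 := by
        split_ifs with h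
        · exact Nat.zero_le _
        · simpa [h] using hB h
      have h1 : (if j = par v then flow par u N (fun v => waiting cp r v M) t v - u v else 0) ≤
          ∑ i ∈ range M, if curAt par cp N t i = v ∧ j = par v then ∑ s ∈ range v, y i s
            else 0 := by
        split_ifs with h
        · simpa [h] using hA
        · exact Nat.zero_le _
      refine (Nat.add_le_add h0 h1).trans ?_
      rw [← sum_add_distrib]
      refine sum_le_sum fun i _ => ?_
      by_cases h2 : curAt par cp N t i = v
      · by_cases h3 : j = par v
        · simp only [h2, h3]
          by_cases h4 : v = par v
          · simp [← h4]
          · simp [h4]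
        · simp only [h2, h3, Ne.symm h3, and_false, if_false, if_true, add_zero]
          rw [if_neg (fun h => h.2 h.1.symm)]
      · simp only [h2, false_and, if_false, add_zero]
        split_ifs <;> omega
  have := key N le_rfl j
  simpa using this

/-! ### Breadth-first search -/

/-- `ord` lists the nodes of a tree such that every node comes after its parent; `pos` is the
inverse of `ord`, and `par` is the parent map `pa` in terms of positions. -/
structure Sorted (N : ℕ) (pa ord pos par : ℕ → ℕ) : Prop where
  ord_lt : ∀ j < N, ord j < N
  pos_lt : ∀ v < N, pos v < N
  pos_ord : ∀ j < N, pos (ord j) = j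
  ord_pos : ∀ v < N, ord (pos v) = v
  par_le : ∀ j < N, par j ≤ j
  par_lt : ∀ j < N, 0 < j → par j < j
  ord_par : ∀ j < N, ord (par j) = pa (ord j)

/-- The invariant of breadth-first search: `len` nodes have been found; the children of the nodes
`ord 0, …, ord (t - 1)` are among them, and so are the children below `v` of `ord t`. -/
structure Search (N root : ℕ) (pa : ℕ → ℕ) (t v : ℕ) (ord pos par : ℕ → ℕ) (len : ℕ) : Prop where
  len_pos : 0 < len
  ord_zero : ord 0 = root
  par_zero : par 0 = 0
  ord_lt : ∀ j < len, ord j < N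
  pos_ord : ∀ j < len, pos (ord j) = j
  found : ∀ j < len, 0 < j → par j < j ∧ ord j ≠ root ∧ pa (ord j) = ord (par j) ∧
    (par j < t ∨ par j = t ∧ ord j < v)
  done : ∀ x < N, x ≠ root → ∀ j < len, pa x = ord j → (j < t ∨ j = t ∧ x < v) →
    pos x < len ∧ ord (pos x) = x

namespace Search

variable {N root : ℕ} {pa : ℕ → ℕ} {t v : ℕ} {ord pos par : ℕ → ℕ} {len : ℕ}

theorem push (h : Search N root pa t v ord pos par len) (ht : t < len) (hv : v < N)
    (hr : v ≠ root) (hp : pa v = ord t) :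
    Search N root pa t (v + 1) (Function.update ord len v) (Function.update pos v len)
      (Function.update par len t) (len + 1) := by
  -- The node `v` is new: had it been found as `ord j`, its discoverer would be `t` by injectivity
  -- of `ord`, and the scan at `t` has so far found only children below `v`.
  have hnew : ∀ j < len, ord j ≠ v := by
    rintro j hj rfl
    have hj0 : 0 < j := Nat.pos_of_ne_zero fun h0 => hr (h0 ▸ h.ord_zero)
    obtain ⟨h1, -, h2, h3⟩ := h.found j hj hj0
    rw [hp] at h2
    have h4 := h.pos_ord t ht
    rw [h2, h.pos_ord _ (by omega)] at h4
    omega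
  have h0 := h.len_pos
  refine ⟨by omega, ?_, ?_, fun j hj => ?_, fun j hj => ?_, fun j hj hj0 => ?_,
    fun x hx hxr j hj hxj hjt => ?_⟩
  · rw [Function.update_of_ne (by omega), h.ord_zero]
  · rw [Function.update_of_ne (by omega), h.par_zero]
  · rw [Function.update_apply]
    split_ifs with hc
    exacts [hv, h.ord_lt j (by omega)]
  · by_cases hc : j = len
    · simp [hc]
    · rw [Function.update_of_ne hc, Function.update_of_ne (hnew j (by omega)),
        h.pos_ord j (by omega)]
  · by_cases hc : j = len
    · subst hc
      rw [Function.update_self, Function.update_self, Function.update_of_ne (by omega)]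
      exact ⟨ht, hr, hp, .inr ⟨rfl, by omega⟩⟩
    · have := h.found j (by omega) hj0
      rw [Function.update_of_ne hc, Function.update_of_ne hc, Function.update_of_ne (by omega)]
      exact ⟨this.1, this.2.1, this.2.2.1, by omega⟩
  · have hjl : j ≠ len := by omega
    rw [Function.update_of_ne hjl] at hxj
    by_cases hc : x = v
    · subst hc; simp
    · obtain ⟨h1, h2⟩ := h.done x hx hxr j (by omega) hxj (by omega)
      rw [Function.update_of_ne hc, Function.update_of_ne (by omega)]
      exact ⟨by omega, h2⟩

theorem skip (h : Search N root pa t v ord pos par len)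
    (hs : v = root ∨ pa v ≠ ord t) : Search N root pa t (v + 1) ord pos par len := by
  refine ⟨h.len_pos, h.ord_zero, h.par_zero, h.ord_lt, h.pos_ord, fun j hj hj0 => ?_,
    fun x hx hxr j hj hxj hjt => ?_⟩
  · have := h.found j hj hj0
    exact ⟨this.1, this.2.1, this.2.2.1, by omega⟩
  · refine h.done x hx hxr j hj hxj ?_
    rcases hjt with hjt | ⟨rfl, hxv⟩
    · exact .inl hjt
    · refine .inr ⟨rfl, lt_of_le_of_ne (by omega) ?_⟩
      rintro rfl
      rcases hs with hs | hs
      exacts [hxr hs, hs hxj]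

theorem next (h : Search N root pa t N ord pos par len) :
    Search N root pa (t + 1) 0 ord pos par len := by
  refine ⟨h.len_pos, h.ord_zero, h.par_zero, h.ord_lt, h.pos_ord, fun j hj hj0 => ?_,
    fun x hx hxr j hj hxj hjt => h.done x hx hxr j hj hxj (by omega)⟩
  have := h.found j hj hj0
  exact ⟨this.1, this.2.1, this.2.2.1, by omega⟩

theorem next_of_le (h : Search N root pa t 0 ord pos par len) (hl : len ≤ t) :
    Search N root pa (t + 1) 0 ord pos par len := by
  refine ⟨h.len_pos, h.ord_zero, h.par_zero, h.ord_lt, h.pos_ord, fun j hj hj0 => ?_,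
    fun x hx hxr j hj hxj hjt => h.done x hx hxr j hj hxj (by omega)⟩
  have := h.found j hj hj0
  exact ⟨this.1, this.2.1, this.2.2.1, by omega⟩

/-- Injectivity of `ord` gives `len ≤ N`. Conversely every node is found, by induction on its
distance from the root, and then `pos` is injective too, so `len = N`. -/
theorem sorted {n : ℕ} (h : Search N root pa n 0 ord pos par len) (hn : N ≤ n)
    (hroot : pa root = root) (hrN : root < N) (hpa : ∀ v < N, pa v < N)
    (hreach : ∀ v < N, ∃ k, pa^[k] v = root) : Sorted N pa ord pos par := by
  have hlen : len ≤ N := by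
    have := card_le_card_of_injOn (s := range len) (t := range N) ord
      (fun j hj => mem_range.2 (h.ord_lt j (mem_range.1 hj)))
      (fun i hi j hj hij => by
        rw [← h.pos_ord i (mem_range.1 hi), ← h.pos_ord j (mem_range.1 hj), hij])
    simpa using this
  have hfound : ∀ k, ∀ v < N, pa^[k] v = root → pos v < len ∧ ord (pos v) = v := by
    have hr : pos root < len ∧ ord (pos root) = root := by
      have := h.pos_ord 0 h.len_pos
      rw [h.ord_zero] at this
      rw [this]
      exact ⟨h.len_pos, h.ord_zero⟩
    intro k
    induction k with
    | zero => rintro v hv rfl; exact hr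
    | succ k ih =>
      intro v hv hk
      by_cases hvr : v = root
      · rwa [hvr]
      obtain ⟨h1, h2⟩ := ih (pa v) (hpa v hv) hk
      exact h.done v hv hvr _ h1 h2.symm (by omega)
  have hall : ∀ v < N, pos v < len ∧ ord (pos v) = v := fun v hv => by
    obtain ⟨k, hk⟩ := hreach v hv
    exact hfound k v hv hk
  have hlen' : N ≤ len := by
    have := card_le_card_of_injOn (s := range N) (t := range len) pos
      (fun v hv => mem_range.2 (hall v (mem_range.1 hv)).1)
      (fun u hu v hv huv => by
        rw [← (hall u (mem_range.1 hu)).2, ← (hall v (mem_range.1 hv)).2, huv])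
    simpa using this
  obtain rfl : len = N := le_antisymm hlen hlen'
  have hlt : ∀ j < len, 0 < j → par j < j := fun j hj hj0 => (h.found j hj hj0).1
  refine ⟨h.ord_lt, fun v hv => (hall v hv).1, h.pos_ord, fun v hv => (hall v hv).2,
    fun j hj => ?_, hlt, fun j hj => ?_⟩
  · rcases Nat.eq_zero_or_pos j with rfl | hj0
    · exact h.par_zero.le
    · exact (hlt j hj hj0).le
  · rcases Nat.eq_zero_or_pos j with rfl | hj0
    · rw [h.par_zero, h.ord_zero, hroot]
    · exact (h.found j hj hj0).2.2.1.symm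

end Search

/-! ### The program

Registers: `0` length of the input, `1` capacity, `2` number of nodes, `3` number of clients.
Arrays: `0` input, `1` output, `2` nodes in sorted order, `3` positions of the nodes, `4` parents in
terms of positions, `5` multiples of the length of the input, `6` requests arriving directly at the
nodes, `7` capacities of the nodes, `8` table of the dynamic program, `9` and `10` auxiliary rows,
`11` current nodes of the clients, `12` remaining requests, `13` multiples of the number of
nodes. -/

/-- Sequential composition of a list of programs. -/
def block : List FProg → FProg
  | [] => .skip
  | p :: l => .seq p (block l)

@[simp] theorem run_block_nil (s : State) : (block []).run s = s := rfl

@[simp] theorem run_block_cons (p : FProg) (l : List FProg) (s : State) :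
    (block (p :: l)).run s = (block l).run (p.run s) := rfl

theorem run_ite (a b : Expr) (p q : FProg) (s : State) :
    (FProg.ite a b p q).run s = if a.eval s < b.eval s then p.run s else q.run s := rfl

/-- Execute `p` if `a = b`. -/
def whenEq (a b : Expr) (p : FProg) : FProg := .ite a b .skip (.ite b a .skip p)

theorem run_whenEq (a b : Expr) (p : FProg) (s : State) :
    (whenEq a b p).run s = if a.eval s = b.eval s then p.run s else s := by
  simp only [whenEq, FProg.run]
  split_ifs <;> first | rfl | omega

/-- Execute `p` if `a ≠ b`. -/
def whenNe (a b : Expr) (p : FProg) : FProg := .ite a b p (.ite b a p .skip)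

theorem run_whenNe (a b : Expr) (p : FProg) (s : State) :
    (whenNe a b p).run s = if a.eval s = b.eval s then s else p.run s := by
  simp only [whenNe, FProg.run]
  split_ifs <;> first | rfl | omega

/-- Append the node in register `6` to the list of nodes. -/
def pushProg : FProg := block [
  .setArr 2 (.reg 4) (.reg 6),
  .setArr 3 (.reg 6) (.reg 4),
  .setArr 4 (.reg 4) (.reg 5),
  .setReg 4 (.add (.reg 4) (.lit 1))]

/-! ### Breadth-first search on the machine -/

def scanProg : FProg := .forN 6 (.reg 2) (whenEq (.get 0 (.add (.lit 4) (.reg 6)))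
  (.get 2 (.reg 5)) (whenNe (.reg 6) (.get 0 (.lit 3)) pushProg))

def searchLoop : FProg := .forN 5 (.reg 0) (.ite (.reg 5) (.reg 4) scanProg .skip)

/-- Breadth-first search. -/
def searchProg : FProg := block [
  .setArr 2 (.lit 0) (.get 0 (.lit 3)),
  .setArr 3 (.get 0 (.lit 3)) (.lit 0),
  .setReg 4 (.lit 1),
  searchLoop]

theorem search_scanProg {s : State} {N root t : ℕ} {pa : ℕ → ℕ}
    (hN : s.reg 2 = N) (hle : N ≤ s.reg 0) (ht : s.reg 5 = t) (hroot : s.arr 0 3 = root)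
    (hpa : ∀ v < N, s.arr 0 (4 + v) = pa v) (htl : t < s.reg 4)
    (h : Search N root pa t 0 (s.arr 2) (s.arr 3) (s.arr 4) (s.reg 4)) :
    Search N root pa t N ((scanProg.run s).arr 2) ((scanProg.run s).arr 3)
      ((scanProg.run s).arr 4) ((scanProg.run s).reg 4) := by
  have := FProg.run_forN (q := scanProg) rfl (s := s) (m := N)
    (fun v s' => t < s'.reg 4 ∧
      Search N root pa t v (s'.arr 2) (s'.arr 3) (s'.arr 4) (s'.reg 4))
    rfl hle (fun s' ha => (ha.reg 2 rfl).trans hN) (fun k s' x hk => by simpa using hk)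
    ⟨htl, h⟩ ?_
  · exact this.2
  · rintro v s' hv hr ha ⟨hlt, hS⟩
    have e5 := (ha.reg 5 rfl).trans ht
    have e0 := ha.arr 0 rfl
    rw [run_whenEq, run_whenNe]
    simp only [Expr.eval, e0, hr, hpa v hv, e5, hroot]
    split_ifs with h1 h2
    · exact ⟨hlt, hS.skip (.inl h2)⟩
    · have := hS.push hlt hv h2 h1
      simpa [pushProg, FProg.run, Expr.eval, State.setArr_arr, hr, e5] using
        (⟨by omega, this⟩ : _ ∧ _)
    · exact ⟨hlt, hS.skip (.inr h1)⟩

theorem sorted_searchProg {s : State} {N root : ℕ} {pa : ℕ → ℕ}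
    (hN : s.reg 2 = N) (hle : N ≤ s.reg 0) (hroot : s.arr 0 3 = root)
    (hpa : ∀ v < N, s.arr 0 (4 + v) = pa v) (h4 : s.arr 4 0 = 0)
    (hpr : pa root = root) (hrN : root < N) (hpaN : ∀ v < N, pa v < N)
    (hreach : ∀ v < N, ∃ k, pa^[k] v = root) :
    Sorted N pa ((searchProg.run s).arr 2) ((searchProg.run s).arr 3)
      ((searchProg.run s).arr 4) := by
  have h0 : (searchProg.run s) = searchLoop.run (((s.setArr 2 0 root).setArr 3 root 0).setReg 4 1) := by
    simp [searchProg, FProg.run, Expr.eval, hroot]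
  set s0 := ((s.setArr 2 0 root).setArr 3 root 0).setReg 4 1 with hs0
  have a0 : s0.arr 0 = s.arr 0 := by simp [hs0, State.setArr_arr]
  have := FProg.run_forN (q := searchLoop) rfl (s := s0) (m := s.reg 0)
    (fun t s' => Search N root pa t 0 (s'.arr 2) (s'.arr 3) (s'.arr 4) (s'.reg 4))
    rfl (by simp [hs0]) (fun s' ha => (ha.reg 0 rfl).trans (by simp [hs0]))
    (fun k s' x hk => by simpa using hk) ?_ ?_
  · rw [h0]
    exact this.sorted hle hpr hrN hpaN hreach
  · refine ⟨by simp [hs0], by simp [hs0], by simp [hs0, h4], ?_, ?_, ?_, ?_⟩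
    · simp [hs0, hrN]
    · simp [hs0]
    · simp [hs0]
    · intro x _ _ j _ _ h; omega
  · intro t s' ht hr ha hS
    rw [run_ite]
    simp only [Expr.eval, hr]
    split_ifs with hlt
    · exact (search_scanProg ((ha.reg 2 rfl).trans (by simpa [hs0])) (by
        rw [ha.reg 0 rfl]; simpa [hs0]) hr (by rw [ha.arr 0 rfl, a0, hroot])
        (by rwa [ha.arr 0 rfl, a0]) hlt hS).next
    -- The outer loop makes as many rounds as the input has words, so it may outlast the list of
    -- found nodes; the surplus rounds do nothing.
    · exact hS.next_of_le (by omega)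

/-- Array `5` becomes the list of the multiples of the length of the input. -/
def rowsProg : FProg := .forN 6 (.reg 0)
  (.setArr 5 (.add (.reg 6) (.lit 1)) (.add (.get 5 (.reg 6)) (.reg 0)))

theorem rowsProg_arr {s : State} (h : s.arr 5 0 = 0) :
    ∀ v ≤ s.reg 0, (rowsProg.run s).arr 5 v = v * s.reg 0 := by
  have key := FProg.run_forN (q := rowsProg) rfl (s := s) (m := s.reg 0)
    (fun k s' => ∀ v ≤ k, s'.arr 5 v = v * s.reg 0)
    rfl le_rfl (fun s' ha => ha.reg 0 rfl) (fun k s' x hk => hk) ?_ ?_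
  · exact key
  · intro v hv
    obtain rfl : v = 0 := by omega
    simpa using h
  · intro k s' hk hr ha h v hv
    simp only [FProg.run, State.setArr_arr_apply, Expr.eval, hr, ha.reg 0 rfl,
      true_and]
    split_ifs with hc
    · rw [hc, h k le_rfl]; ring
    · exact h v (by omega)

/-- Array `13` becomes the list of the multiples of the number of nodes. -/
def offsetsProg : FProg := .forN 12 (.reg 3)
  (.setArr 13 (.add (.reg 12) (.lit 1)) (.add (.get 13 (.reg 12)) (.reg 2)))

theorem offsetsProg_arr {s : State} (h : s.arr 13 0 = 0) (hle : s.reg 3 ≤ s.reg 0) :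
    ∀ i ≤ s.reg 3, (offsetsProg.run s).arr 13 i = i * s.reg 2 := by
  have key := FProg.run_forN (q := offsetsProg) rfl (s := s) (m := s.reg 3)
    (fun k s' => ∀ v ≤ k, s'.arr 13 v = v * s.reg 2)
    rfl hle (fun s' ha => ha.reg 3 rfl) (fun k s' x hk => hk) ?_ ?_
  · exact key
  · intro v hv
    obtain rfl : v = 0 := by omega
    simpa using h
  · intro k s' hk hr ha h v hv
    simp only [FProg.run, State.setArr_arr_apply, Expr.eval, hr, ha.reg 2 rfl,
      true_and]
    split_ifs with hc
    · rw [hc, h k le_rfl]; ring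
    · exact h v (by omega)

/-- The position of the parent of the client in register `12`. -/
def clientPos : Expr := .get 3 (.get 0 (.add (.add (.lit 4) (.reg 2)) (.reg 12)))

/-- The number of requests of the client in register `12`. -/
def clientReq : Expr := .get 0 (.add (.add (.add (.lit 4) (.reg 2)) (.reg 3)) (.reg 12))

/-- Array `6` becomes the list of the numbers of requests arriving directly at the nodes. -/
def loadProg : FProg := .forN 12 (.reg 3)
  (.setArr 6 clientPos (.add (.get 6 clientPos) clientReq))

theorem loadProg_arr {s : State} {cp r : ℕ → ℕ} {M : ℕ} (hM : s.reg 3 = M)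
    (h : ∀ v, s.arr 6 v = 0) (hle : M ≤ s.reg 0)
    (hcp : ∀ i < M, s.arr 3 (s.arr 0 (4 + s.reg 2 + i)) = cp i)
    (hr : ∀ i < M, s.arr 0 (4 + s.reg 2 + M + i) = r i) :
    (loadProg.run s).arr 6 = fun v => waiting cp r v M := by
  funext v
  have key := FProg.run_forN (q := loadProg) rfl (s := s) (m := M)
    (fun k s' => ∀ v, s'.arr 6 v = waiting cp r v k)
    rfl hle (fun s' ha => (ha.reg 3 rfl).trans hM) (fun k s' x hk => hk) ?_ ?_
  · exact key v
  · intro v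
    simpa [waiting] using h v
  · intro k s' hk hk' ha h v
    simp only [FProg.run, State.setArr_arr_apply, Expr.eval, hk', ha.reg 2 rfl, ha.reg 3 rfl,
      ha.arr 0 rfl, ha.arr 3 rfl, clientPos, clientReq, hM, hcp k hk, hr k hk, h]
    simp only [waiting, sum_range_succ]
    by_cases hc : v = cp k
    · simp [hc]
    · simp [hc, Ne.symm hc]

/-- All nodes get full capacity. -/
def fillProg : FProg := .forN 6 (.reg 2) (.setArr 7 (.reg 6) (.reg 1))

theorem fillProg_arr {s : State} (hle : s.reg 2 ≤ s.reg 0) :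
    ∀ v < s.reg 2, (fillProg.run s).arr 7 v = s.reg 1 := by
  have key := FProg.run_forN (q := fillProg) rfl (s := s) (m := s.reg 2)
    (fun k s' => ∀ v < k, s'.arr 7 v = s.reg 1)
    rfl hle (fun s' ha => ha.reg 2 rfl) (fun k s' x hk => hk) ?_ ?_
  · exact key
  · intro v hv; omega
  · intro k s' hk hr ha h v hv
    simp only [FProg.run, State.setArr_arr_apply, Expr.eval, hr, ha.reg 1 rfl,
      true_and]
    split_ifs with hc
    · rfl
    · exact h v (by omega)

/-! ### The dynamic program on the machine -/

/-- Uniqueness of division with remainder: distinct entries of a two-dimensional table stored row by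
row occupy distinct cells. -/
theorem row_inj {n v a k k' : ℕ} (hk : k < n) (hk' : k' < n) (h : v * n + k = a * n + k') :
    v = a ∧ k = k' := by
  have : v = a := by
    rcases lt_trichotomy v a with hlt | rfl | hlt
    · have := Nat.mul_le_mul_right n (Nat.succ_le_of_lt hlt)
      rw [Nat.succ_mul] at this
      omega
    · rfl
    · have := Nat.mul_le_mul_right n (Nat.succ_le_of_lt hlt)
      rw [Nat.succ_mul] at this
      omega
  subst this
  exact ⟨rfl, by omega⟩

/-- Entry `k` depends on entries up to `k` only, so it is harmless that the machine stores just an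
initial segment of each row. -/
theorem infConv_congr {A A' F F' : ℕ → ℕ} {k : ℕ} (hA : ∀ i ≤ k, A i = A' i)
    (hF : ∀ i ≤ k, F i = F' i) : infConv A F k = infConv A' F' k := by
  have : ∀ j ≤ k + 1, runMin A F k j = runMin A' F' k j := by
    intro j hj
    induction j with
    | zero => simp only [runMin, hA k le_rfl, hF 0 (Nat.zero_le _)]
    | succ j ih => simp only [runMin, ih (by omega), hA (k - j) (by omega), hF j (by omega)]
  exact this _ le_rfl

/-- The values of `e` for the values `0, 1, …` of register `7` are written into the row of array
`8` that begins at the address in register `x`. -/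
def storeRow (x : ℕ) (e : Expr) : FProg :=
  .forN 7 (.reg 0) (.setArr 8 (.add (.reg x) (.reg 7)) e)

theorem storeRow_arr {s : State} {x : ℕ} {e : Expr} {a n : ℕ} {f : ℕ → ℕ} (hx : x ≠ 7)
    (hn : s.reg 0 = n) (ha : s.reg x = a * n)
    (he : ∀ s' k, s'.reg 7 = k → k < n → FProg.Agree (storeRow x e) s s' → e.eval s' = f k) :
    (∀ k < n, ((storeRow x e).run s).arr 8 (a * n + k) = f k) ∧
      ∀ v ≠ a, ∀ k < n, ((storeRow x e).run s).arr 8 (v * n + k) = s.arr 8 (v * n + k) := by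
  have key := FProg.run_forN (q := storeRow x e) rfl (s := s) (m := n)
    (fun m s' => (∀ k < m, s'.arr 8 (a * n + k) = f k) ∧
      ∀ v ≠ a, ∀ k < n, s'.arr 8 (v * n + k) = s.arr 8 (v * n + k))
    rfl hn.ge (fun s' ha => (ha.reg 0 rfl).trans hn) (fun k s' x hk => hk) ?_ ?_
  · exact key
  · exact ⟨fun k hk => by omega, fun _ _ _ _ => rfl⟩
  · intro m s' hm hr hag h
    have hx' : s'.reg x = a * n := by
      rw [hag.reg x, ha]
      simp [storeRow, FProg.writesReg, hx.symm]
    simp only [FProg.run, State.setArr_arr_apply, Expr.eval, hr, hx', he s' m hr hm hag, true_and]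
    refine ⟨fun k hk => ?_, fun v hv k hk => ?_⟩
    · split_ifs with hc
      · congr 1; omega
      · exact h.1 k (by omega)
    · rw [if_neg fun hc => hv (row_inj hk hm hc).1]
      exact h.2 v hv k hk

/-- Array `9` becomes the row of the requests leaving the node in register `6`. -/
def leavingProg : FProg := .forN 7 (.reg 0) (block [
  .setArr 9 (.reg 7) (.get 8 (.add (.reg 10) (.reg 7))),
  .ite (.lit 0) (.reg 7)
    (.ite (.sub (.get 8 (.add (.reg 10) (.sub (.reg 7) (.lit 1)))) (.get 7 (.reg 6)))
      (.get 9 (.reg 7))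
      (.setArr 9 (.reg 7)
        (.sub (.get 8 (.add (.reg 10) (.sub (.reg 7) (.lit 1)))) (.get 7 (.reg 6)))) .skip)
    .skip])

theorem leavingProg_arr {s : State} {n v a : ℕ} {G : ℕ → ℕ → ℕ} (hn : s.reg 0 = n)
    (hv : s.reg 6 = v) (ha : s.reg 10 = a) (hG : ∀ k < n, s.arr 8 (a + k) = G v k) :
    ∀ k < n, (leavingProg.run s).arr 9 k = leaving (s.arr 7) G v k := by
  have key := FProg.run_forN (q := leavingProg) rfl (s := s) (m := n)
    (fun m s' => ∀ k < m, s'.arr 9 k = leaving (s.arr 7) G v k)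
    rfl hn.ge (fun s' ha => (ha.reg 0 rfl).trans hn) (fun k s' x hk => hk) ?_ ?_
  · exact key
  · exact fun k hk => by omega
  · intro m s' hm hr hag h k hk
    have e6 := (hag.reg 6 rfl).trans hv
    have e10 := (hag.reg 10 rfl).trans ha
    have e7 := hag.arr 7 rfl
    have e8 := hag.arr 8 rfl
    have h1 := hG m hm
    have h2 := hG (m - 1) (by omega)
    simp only [run_block_cons, run_block_nil, FProg.run, Expr.eval, State.setArr_arr_apply,
      State.setArr_reg, hr, e6, e10, e7, e8, h1, h2]
    by_cases hc : k = m
    · subst hc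
      simp only [leaving]
      rcases Nat.eq_zero_or_pos k with h0 | h0
      · subst h0; simp
      · simp [h0.ne', h0]
        split_ifs with h3
        · simp
          omega
        · simp
          omega
    · have := h k (by omega)
      split_ifs <;> simp [hc, this]

def convInner : FProg := .forN 8 (.add (.reg 7) (.lit 1))
  (.ite (.add (.get 8 (.add (.reg 11) (.sub (.reg 7) (.reg 8)))) (.get 9 (.reg 8)))
    (.get 10 (.reg 7))
    (.setArr 10 (.reg 7)
      (.add (.get 8 (.add (.reg 11) (.sub (.reg 7) (.reg 8)))) (.get 9 (.reg 8)))) .skip)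

/-- Array `10` becomes the infimal convolution of array `9` and the row of array `8` that begins at
the address in register `11`. -/
def convProg : FProg := .forN 7 (.reg 0) (block [
  .setArr 10 (.reg 7) (.add (.get 8 (.add (.reg 11) (.reg 7))) (.get 9 (.lit 0))),
  convInner])

theorem convInner_arr {s : State} {k a : ℕ} (hk : s.reg 7 = k) (hk' : k < s.reg 0)
    (ha : s.reg 11 = a) (h0 : s.arr 10 k = s.arr 8 (a + k) + s.arr 9 0) :
    (convInner.run s).arr 10 k = infConv (fun i => s.arr 8 (a + i)) (s.arr 9) k ∧
      ∀ i ≠ k, (convInner.run s).arr 10 i = s.arr 10 i := by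
  have key := FProg.run_forN (q := convInner) rfl (s := s) (m := k + 1)
    (fun j s' => s'.arr 10 k = runMin (fun i => s.arr 8 (a + i)) (s.arr 9) k j ∧
      ∀ i ≠ k, s'.arr 10 i = s.arr 10 i)
    rfl hk' (fun s' ha => by simp [Expr.eval, ha.reg 7 rfl, hk]) (fun k s' x hk => hk) ?_ ?_
  · exact key
  · exact ⟨h0, fun _ _ => rfl⟩
  · intro j s' hj hr hag h
    have e7 := (hag.reg 7 rfl).trans hk
    have e11 := (hag.reg 11 rfl).trans ha
    have e9 := hag.arr 9 rfl
    have e8 := hag.arr 8 rfl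
    simp only [FProg.run, Expr.eval, hr, e7, e11, e9, e8, h.1, runMin]
    split_ifs with hc
    · refine ⟨?_, fun i hi => ?_⟩
      · simp only [State.setArr_arr_apply, and_self, if_true]
        exact (min_eq_right hc.le).symm
      · simp only [State.setArr_arr_apply, hi, and_false, if_false]
        exact h.2 i hi
    · exact ⟨h.1.trans (min_eq_left (not_lt.1 hc)).symm, h.2⟩

theorem convProg_arr {s : State} {n a : ℕ} (hn : s.reg 0 = n) (ha : s.reg 11 = a) :
    ∀ k < n, (convProg.run s).arr 10 k = infConv (fun i => s.arr 8 (a + i)) (s.arr 9) k := by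
  have key := FProg.run_forN (q := convProg) rfl (s := s) (m := n)
    (fun m s' => ∀ k < m, s'.arr 10 k = infConv (fun i => s.arr 8 (a + i)) (s.arr 9) k)
    rfl hn.ge (fun s' ha => (ha.reg 0 rfl).trans hn) (fun k s' x hk => hk) ?_ ?_
  · exact key
  · exact fun k hk => by omega
  · intro m s' hm hr hag h k hk
    have e0 := (hag.reg 0 rfl).trans hn
    have e11 := (hag.reg 11 rfl).trans ha
    have e9 := hag.arr 9 rfl
    have e8 := hag.arr 8 rfl
    simp only [run_block_cons, run_block_nil]
    set s1 := (FProg.setArr 10 (.reg 7)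
      (.add (.get 8 (.add (.reg 11) (.reg 7))) (.get 9 (.lit 0)))).run s' with hs1
    have f8 : s1.arr 8 = s.arr 8 := by simp [hs1, FProg.run, State.setArr_arr, e8]
    have f9 : s1.arr 9 = s.arr 9 := by simp [hs1, FProg.run, State.setArr_arr, e9]
    obtain ⟨h1, h2⟩ := convInner_arr (s := s1) (k := m) (a := a) hr (by
      simp only [hs1, FProg.run, State.setArr_reg]; omega) e11 (by
      simp only [f8, f9]; simp [hs1, FProg.run, Expr.eval, hr, e11, e8, e9])
    rw [f8, f9] at h1
    by_cases hc : k = m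
    · rw [hc]; exact h1
    · rw [h2 k hc, ← h k (by omega)]
      simp [hs1, FProg.run, Expr.eval, hr, hc]

/-- Registers `6`, `10`, `11` receive the node to be visited and the beginnings of its row and of
the row of its parent. -/
def visitHead : FProg := block [
  .setReg 6 (.sub (.reg 2) (.add (.reg 5) (.lit 1))),
  .setReg 10 (.get 5 (.reg 6)),
  .setReg 11 (.get 5 (.get 4 (.reg 6)))]

/-- The visit of a node in the dynamic program. -/
def visitProg : FProg := block [
  visitHead,
  leavingProg,
  storeRow 10 (.lit 0),
  convProg,
  storeRow 11 (.get 10 (.reg 7))]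

/-- The order of the passes matters at the root, which is its own parent: its row must be saved in
array `9` before being cleared, and cleared before the convolution reads it. The result is built in
array `10`, since each entry needs the old row of the parent. -/
theorem visitProg_arr {s : State} {n N v : ℕ} {G : ℕ → ℕ → ℕ} (hn : s.reg 0 = n)
    (hv : s.reg 2 - (s.reg 5 + 1) = v) (hvN : v < N) (hp : s.arr 4 v ≤ v) (hN : N ≤ n)
    (h5 : ∀ v ≤ n, s.arr 5 v = v * n)
    (hG : ∀ v < N, ∀ k < n, s.arr 8 (v * n + k) = G v k) :
    ∀ x < N, ∀ k < n, (visitProg.run s).arr 8 (x * n + k) =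
      tableStep (s.arr 4) (s.arr 7) G v x k := by
  set p := s.arr 4 v with hpv
  set s1 := visitHead.run s with hs1
  set s2 := leavingProg.run s1 with hs2
  set s3 := (storeRow 10 (.lit 0)).run s2 with hs3
  set s4 := convProg.run s3 with hs4
  have hrun : visitProg.run s = (storeRow 11 (.get 10 (.reg 7))).run s4 := rfl
  have a1 : s1.arr = s.arr := rfl
  have r0 : s1.reg 0 = n := hn
  have r6 : s1.reg 6 = v := by simp [hs1, visitHead, FProg.run, Expr.eval, hv]
  have r10 : s1.reg 10 = v * n := by
    simp [hs1, visitHead, FProg.run, Expr.eval, hv, h5 v (by omega)]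
  have r11 : s1.reg 11 = p * n := by
    simp [hs1, visitHead, FProg.run, Expr.eval, hv, ← hpv, h5 p (by omega)]
  have h2 := leavingProg_arr r0 r6 r10 (G := G) (by rw [a1]; exact hG v hvN)
  rw [← hs2, a1] at h2
  have e2 : s2.arr 8 = s.arr 8 := FProg.run_arr leavingProg s1 8 rfl
  have h3 := storeRow_arr (s := s2) (x := 10) (e := .lit 0) (a := v) (n := n) (f := fun _ => 0)
    (by norm_num) ((FProg.run_reg leavingProg s1 0 rfl).trans r0)
    ((FProg.run_reg leavingProg s1 10 rfl).trans r10) (fun _ _ _ _ _ => rfl)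
  rw [← hs3, e2] at h3
  have q0 : s3.reg 0 = n := (FProg.run_reg (storeRow 10 (.lit 0)) s2 0 rfl).trans
    ((FProg.run_reg leavingProg s1 0 rfl).trans r0)
  have q11 : s3.reg 11 = p * n := (FProg.run_reg (storeRow 10 (.lit 0)) s2 11 rfl).trans
    ((FProg.run_reg leavingProg s1 11 rfl).trans r11)
  have e3 : s3.arr 9 = s2.arr 9 := FProg.run_arr (storeRow 10 (.lit 0)) s2 9 rfl
  have hG3 : ∀ x < N, ∀ k < n, s3.arr 8 (x * n + k) =
      Function.update G v (fun _ => 0) x k := by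
    intro x hx k hk
    by_cases hc : x = v
    · rw [hc, h3.1 k hk, Function.update_self]
    · rw [h3.2 x hc k hk, Function.update_of_ne hc, hG x hx k hk]
  have h4 := convProg_arr q0 q11
  rw [← hs4, e3] at h4
  have e4 : s4.arr 8 = s3.arr 8 := FProg.run_arr convProg s3 8 rfl
  have h5 := storeRow_arr (s := s4) (x := 11) (e := .get 10 (.reg 7)) (a := p) (n := n)
    (f := s4.arr 10) (by norm_num) ((FProg.run_reg convProg s3 0 rfl).trans q0)
    ((FProg.run_reg convProg s3 11 rfl).trans q11)
    (fun s' k hk _ ha => by simp only [Expr.eval, hk, ha.arr 10 rfl])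
  rw [e4] at h5
  rw [hrun]
  intro x hx k hk
  simp only [tableStep, ← hpv]
  by_cases hc : x = p
  · rw [hc, h5.1 k hk, h4 k hk, Function.update_self]
    refine infConv_congr (fun i hi => ?_) (fun i hi => h2 i (by omega))
    exact hG3 p (by omega) i (by omega)
  · rw [h5.2 x hc k hk, Function.update_of_ne hc, hG3 x hx k hk]

def tableInit : FProg := .forN 6 (.reg 2) (block [
  .setReg 10 (.get 5 (.reg 6)),
  storeRow 10 (.get 6 (.reg 6))])

def tableLoop : FProg := .forN 5 (.reg 2) visitProg

/-- The dynamic program. -/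
def tableProg : FProg := block [tableInit, tableLoop]

theorem tableProg_arr {s : State} {n N : ℕ} (hn : s.reg 0 = n) (h2 : s.reg 2 = N) (hN : N ≤ n)
    (hp : ∀ v < N, s.arr 4 v ≤ v) (h5 : ∀ v ≤ n, s.arr 5 v = v * n) :
    ∀ x < N, ∀ k < n, (tableProg.run s).arr 8 (x * n + k) =
      table (s.arr 4) (s.arr 7) N (s.arr 6) N x k := by
  set s1 := tableInit.run s with hs1
  have hrun : tableProg.run s = tableLoop.run s1 := rfl
  have init : ∀ x < N, ∀ k < n, s1.arr 8 (x * n + k) = s.arr 6 x := by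
    have key := FProg.run_forN (q := tableInit) rfl (s := s) (m := N)
      (fun m s' => ∀ x < m, ∀ k < n, s'.arr 8 (x * n + k) = s.arr 6 x)
      rfl (by omega) (fun s' ha => (ha.reg 2 rfl).trans h2) (fun k s' x hk => hk) ?_ ?_
    · exact key
    · exact fun x hx => by omega
    · intro m s' hm hr hag h x hx k hk
      simp only [run_block_cons, run_block_nil]
      have e6 := hag.arr 6 rfl
      have := storeRow_arr (s := (FProg.setReg 10 (.get 5 (.reg 6))).run s') (x := 10)
        (e := .get 6 (.reg 6)) (a := m) (n := n) (f := fun _ => s.arr 6 m) (by norm_num)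
        ((hag.reg 0 rfl).trans hn)
        (by simp [FProg.run, Expr.eval, hr, hag.arr 5 rfl, h5 m (by omega)])
        (fun s'' k _ _ ha => by
          simp only [Expr.eval, ha.arr 6 rfl, ha.reg 6 rfl]
          simp [FProg.run, hr, e6])
      by_cases hc : x = m
      · rw [hc]; exact this.1 k hk
      · exact (this.2 x hc k hk).trans (h x (by omega) k hk)
  have f0 : s1.reg 0 = n := (FProg.run_reg tableInit s 0 rfl).trans hn
  have f2 : s1.reg 2 = N := (FProg.run_reg tableInit s 2 rfl).trans h2
  have f4 : s1.arr 4 = s.arr 4 := FProg.run_arr tableInit s 4 rfl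
  have f5 : s1.arr 5 = s.arr 5 := FProg.run_arr tableInit s 5 rfl
  have f7 : s1.arr 7 = s.arr 7 := FProg.run_arr tableInit s 7 rfl
  rw [hrun]
  have key := FProg.run_forN (q := tableLoop) rfl (s := s1) (m := N)
    (fun t s' => ∀ x < N, ∀ k < n, s'.arr 8 (x * n + k) =
      table (s.arr 4) (s.arr 7) N (s.arr 6) t x k)
    rfl (by omega) (fun s' ha => (ha.reg 2 rfl).trans f2) (fun k s' x hk => hk) ?_ ?_
  · exact key
  · exact init
  · intro t s' ht hr hag h
    have g4 := (hag.arr 4 rfl).trans f4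
    have g5 := (hag.arr 5 rfl).trans f5
    have g7 := (hag.arr 7 rfl).trans f7
    have := visitProg_arr (s := s') (n := n) (N := N) (v := N - (t + 1)) ((hag.reg 0 rfl).trans f0)
      (by rw [hr, (hag.reg 2 rfl).trans f2]) (by omega) (by rw [g4]; exact hp _ (by omega)) hN
      (by rwa [g5]) h
    rwa [g4, g7] at this

/-- Register `15` receives the least index of a zero in array `8`. -/
def leastProg : FProg := block [
  .setReg 15 (.reg 0),
  .forN 5 (.reg 0) (block [
    .setReg 7 (.sub (.reg 0) (.add (.reg 5) (.lit 1))),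
    .ite (.get 8 (.reg 7)) (.lit 1) (.setReg 15 (.reg 7)) .skip])]

/-- The scan descends, so the last zero recorded is the least one. The initial value `n` survives
only if there is no zero below `n`. -/
theorem leastProg_reg {s : State} {n : ℕ} (hn : s.reg 0 = n) :
    (leastProg.run s).reg 15 ≤ n ∧
      ((leastProg.run s).reg 15 < n → s.arr 8 ((leastProg.run s).reg 15) = 0) ∧
      ∀ k < n, k < (leastProg.run s).reg 15 → s.arr 8 k ≠ 0 := by
  set s0 := (FProg.setReg 15 (.reg 0)).run s with hs0
  have f0 : s0.reg 0 = n := hn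
  have f8 : s0.arr 8 = s.arr 8 := rfl
  have key := FProg.run_forN (q := .forN 5 (.reg 0) (block [
    .setReg 7 (.sub (.reg 0) (.add (.reg 5) (.lit 1))),
    .ite (.get 8 (.reg 7)) (.lit 1) (.setReg 15 (.reg 7)) .skip])) rfl (s := s0) (m := n)
    (fun t s' => s'.reg 15 ≤ n ∧ (s'.reg 15 < n → s.arr 8 (s'.reg 15) = 0) ∧
      ∀ k < n, n - t ≤ k → k < s'.reg 15 → s.arr 8 k ≠ 0)
    rfl f0.ge (fun s' ha => (ha.reg 0 rfl).trans f0) (fun k s' x hk => by simpa using hk) ?_ ?_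
  · exact ⟨key.1, key.2.1, fun k hk => key.2.2 k hk (by omega)⟩
  · have : s0.reg 15 = n := by simp [hs0, FProg.run, Expr.eval, hn]
    rw [this]
    exact ⟨le_rfl, fun h => absurd h (lt_irrefl _), fun k hk hk' => by omega⟩
  · intro t s' ht hr hag h
    have e0 := (hag.reg 0 rfl).trans f0
    have e8 := (hag.arr 8 rfl).trans f8
    simp only [run_block_cons, run_block_nil, FProg.run, Expr.eval, hr, e0, State.setReg_arr, e8,
      State.setReg_reg, if_true]
    split_ifs with hc
    · simp only [State.setReg_reg, if_true]
      exact ⟨by omega, fun _ => by omega, fun k hk hk' hk'' => by omega⟩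
    · simp only [State.setReg_reg]
      refine ⟨h.1, h.2.1, fun k hk hk' hk'' => ?_⟩
      by_cases hkt : k = n - (t + 1)
      · rw [hkt]; omega
      · exact h.2.2 k hk (by omega) hk''

/-- Remove superfluous replicas. -/
def thinProg : FProg := .forN 17 (.reg 2) (block [
  .setArr 7 (.reg 17) (.lit 0),
  tableProg,
  .ite (.lit 0) (.get 8 (.reg 15)) (.setArr 7 (.reg 17) (.reg 1)) .skip])

theorem thinProg_arr {s : State} {n N W K : ℕ} (hn : s.reg 0 = n) (h2 : s.reg 2 = N)
    (h1 : s.reg 1 = W) (h15 : s.reg 15 = K) (hK : K < n) (hN : N ≤ n)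
    (hp : ∀ v < N, s.arr 4 v ≤ v) (h5 : ∀ v ≤ n, s.arr 5 v = v * n)
    (h7 : ∀ v < N, s.arr 7 v = W) :
    ∀ v < N, (thinProg.run s).arr 7 v = thin (s.arr 4) W N (s.arr 6) K N v := by
  have key := FProg.run_forN (q := thinProg) rfl (s := s) (m := N)
    (fun q s' => ∀ v < N, s'.arr 7 v = thin (s.arr 4) W N (s.arr 6) K q v)
    rfl (by omega) (fun s' ha => (ha.reg 2 rfl).trans h2) (fun k s' x hk => hk) ?_ ?_
  · exact key
  · exact h7
  · intro q s' hq hr hag h v hv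
    simp only [run_block_cons, run_block_nil]
    set s1 := (FProg.setArr 7 (.reg 17) (.lit 0)).run s' with hs1
    have g : ∀ x, x ≠ 7 → s1.arr x = s'.arr x := fun x hx => by
      simp [hs1, FProg.run, State.setArr_arr, hx]
    have g7 : s1.arr 7 = Function.update (s'.arr 7) q 0 := by
      simp [hs1, FProg.run, State.setArr_arr, hr, Expr.eval]
    have g4 : s1.arr 4 = s.arr 4 := (g 4 (by norm_num)).trans (hag.arr 4 rfl)
    have g5 : s1.arr 5 = s.arr 5 := (g 5 (by norm_num)).trans (hag.arr 5 rfl)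
    have g6 : s1.arr 6 = s.arr 6 := (g 6 (by norm_num)).trans (hag.arr 6 rfl)
    have ht := tableProg_arr (s := s1) (n := n) (N := N) ((hag.reg 0 rfl).trans hn)
      ((hag.reg 2 rfl).trans h2) hN (by rwa [g4]) (by rwa [g5]) 0 (by omega) K hK
    -- Array `7` is known only below `N`, which is all that the table depends on.
    rw [g4, g6, table_congr (w' := Function.update (thin (s.arr 4) W N (s.arr 6) K q) q 0) le_rfl
      (by
        intro x hx
        rw [g7, Function.update_apply, Function.update_apply]
        split_ifs
        exacts [rfl, h x hx]), zero_mul, zero_add] at ht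
    set s2 := tableProg.run s1 with hs2
    have k15 : s2.reg 15 = K := (FProg.run_reg tableProg s1 15 rfl).trans
      ((hag.reg 15 rfl).trans h15)
    have k17 : s2.reg 17 = q := (FProg.run_reg tableProg s1 17 rfl).trans hr
    have k1 : s2.reg 1 = W := (FProg.run_reg tableProg s1 1 rfl).trans ((hag.reg 1 rfl).trans h1)
    have k7 : s2.arr 7 = s1.arr 7 := FProg.run_arr tableProg s1 7 rfl
    simp only [FProg.run, Expr.eval, k15, ht, k17, k1]
    rw [thin, Function.update_apply]
    by_cases hz : table (s.arr 4) (Function.update (thin (s.arr 4) W N (s.arr 6) K q) q 0) N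
        (s.arr 6) N 0 K = 0
    · simp only [hz, lt_irrefl, if_false, if_true]
      rw [k7, g7, Function.update_apply]
      split_ifs
      exacts [rfl, h v hv]
    · simp only [hz, if_false, Nat.pos_of_ne_zero hz, if_true, State.setArr_arr_apply, true_and]
      split_ifs with hc
      · rfl
      · rw [k7, g7, Function.update_of_ne hc]
        exact h v hv

/-- The requests of all clients are put at the parents of the clients. -/
def startProg : FProg := .forN 12 (.reg 3) (block [
  .setArr 11 (.reg 12) clientPos,
  .setArr 12 (.reg 12) clientReq])

theorem startProg_arr {s : State} {cp r : ℕ → ℕ} {M : ℕ} (hM : s.reg 3 = M) (hle : M ≤ s.reg 0)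
    (hcp : ∀ i < M, s.arr 3 (s.arr 0 (4 + s.reg 2 + i)) = cp i)
    (hr : ∀ i < M, s.arr 0 (4 + s.reg 2 + M + i) = r i) :
    ∀ i < M, (startProg.run s).arr 11 i = cp i ∧ (startProg.run s).arr 12 i = r i := by
  have key := FProg.run_forN (q := startProg) rfl (s := s) (m := M)
    (fun k s' => ∀ i < k, s'.arr 11 i = cp i ∧ s'.arr 12 i = r i)
    rfl hle (fun s' ha => (ha.reg 3 rfl).trans hM) (fun k s' x hk => hk) ?_ ?_
  · exact key
  · exact fun i hi => by omega
  · intro k s' hk hk' ha h i hi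
    have e2 := ha.reg 2 rfl
    have e3 := (ha.reg 3 rfl).trans hM
    have a0 := ha.arr 0 rfl
    have a3 := ha.arr 3 rfl
    simp only [run_block_cons, run_block_nil, FProg.run, State.setArr_arr_apply, State.setArr_reg,
      Expr.eval, hk', e2, e3, clientPos, clientReq, a0, a3]
    by_cases hc : i = k
    · subst hc
      simp [hcp i hk, hr i hk]
    · simpa [hc] using h i (by omega)

/-! ### Serving the clients on the machine -/

def serveClient : FProg := whenEq (.get 11 (.reg 12)) (.reg 6) (block [
  .setReg 14 (.get 12 (.reg 12)),
  .ite (.reg 13) (.reg 14) (.setReg 14 (.reg 13)) .skip,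
  .setArr 1 (.add (.add (.get 13 (.reg 12)) (.get 2 (.reg 6))) (.lit 1)) (.reg 14),
  .setArr 12 (.reg 12) (.sub (.get 12 (.reg 12)) (.reg 14)),
  .setReg 13 (.sub (.reg 13) (.reg 14)),
  .setArr 11 (.reg 12) (.get 4 (.reg 6))])

/-- The node in register `6` serves requests up to the capacity in register `13`. -/
def serveProg : FProg := .forN 12 (.reg 3) serveClient

theorem run_serveClient {s : State} {i v c : ℕ} (hi : s.reg 12 = i) (hv : s.reg 6 = v)
    (hc : s.reg 13 = c) (h : s.arr 11 i = v) :
    (serveClient.run s).reg 13 = c - min (s.arr 12 i) c ∧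
    (serveClient.run s).arr 11 = Function.update (s.arr 11) i (s.arr 4 v) ∧
    (serveClient.run s).arr 12 = Function.update (s.arr 12) i (s.arr 12 i - min (s.arr 12 i) c) ∧
    (serveClient.run s).arr 1 =
      Function.update (s.arr 1) (s.arr 13 i + s.arr 2 v + 1) (min (s.arr 12 i) c) := by
  rw [serveClient, run_whenEq]
  simp only [Expr.eval, hi, hv, h, if_true, run_block_cons, run_block_nil, FProg.run]
  by_cases hlt : c < s.arr 12 i
  · rw [min_eq_right hlt.le]
    simp [hi, hv, hc, hlt, State.setArr_arr]
  · rw [min_eq_left (not_lt.1 hlt)]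
    simp [hi, hv, hc, hlt, State.setArr_arr]

/-- Register `13` holds the capacity not yet spent at `v`. Each client writes at most one cell of
its own output row, the one for the original label `o` of `v`; the offset `1` leaves room for the
flag in cell `0`. -/
theorem serveProg_arr {s : State} {N M v c o : ℕ} {cur rem : ℕ → ℕ} (hM : s.reg 3 = M)
    (hle : M ≤ s.reg 0) (hv : s.reg 6 = v) (hc : s.reg 13 = c) (ho : s.arr 2 v = o) (hoN : o < N)
    (h13 : ∀ i < M, s.arr 13 i = i * N) (hcur : ∀ i < M, s.arr 11 i = cur i)
    (hrem : ∀ i < M, s.arr 12 i = rem i) :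
    ∀ i < M, (serveProg.run s).arr 11 i = (if cur i = v then s.arr 4 v else cur i) ∧
      (serveProg.run s).arr 12 i = rem i - served cur rem c v i ∧
      ∀ x < N, (serveProg.run s).arr 1 (i * N + x + 1) =
        if x = o ∧ cur i = v then served cur rem c v i else s.arr 1 (i * N + x + 1) := by
  have key := FProg.run_forN (q := serveProg) rfl (s := s) (m := M)
    (fun m s' => s'.reg 13 = c - waiting cur rem v m ∧
      (∀ i < m, s'.arr 11 i = (if cur i = v then s.arr 4 v else cur i) ∧
        s'.arr 12 i = rem i - served cur rem c v i ∧
        ∀ x < N, s'.arr 1 (i * N + x + 1) =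
          if x = o ∧ cur i = v then served cur rem c v i else s.arr 1 (i * N + x + 1)) ∧
      ∀ i < M, m ≤ i → s'.arr 11 i = cur i ∧ s'.arr 12 i = rem i ∧
        ∀ x < N, s'.arr 1 (i * N + x + 1) = s.arr 1 (i * N + x + 1))
    rfl hle (fun s' ha => (ha.reg 3 rfl).trans hM) (fun k s' x hk => by simpa using hk) ?_ ?_
  · exact key.2.1
  · exact ⟨by simp [waiting, hc], fun i hi => by omega,
      fun i hi _ => ⟨hcur i hi, hrem i hi, fun _ _ => rfl⟩⟩
  · rintro m s' hm hr hag ⟨hreg, hdone, htodo⟩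
    have e6 := (hag.reg 6 rfl).trans hv
    have a2 := hag.arr 2 rfl
    have a4 := hag.arr 4 rfl
    have a13 := hag.arr 13 rfl
    obtain ⟨t1, t2, t3⟩ := htodo m hm le_rfl
    by_cases hcm : cur m = v
    · obtain ⟨r1, r2, r3, r4⟩ := run_serveClient hr e6 hreg (t1.trans hcm)
      have hsv : min (s'.arr 12 m) (c - waiting cur rem v m) = served cur rem c v m := by
        simp [served, hcm, t2]
      rw [hsv] at r1 r3 r4
      rw [a2, ho, a13, h13 m hm] at r4
      rw [t2] at r3
      rw [r1, r2, r3, r4, a4]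
      refine ⟨?_, fun i hi => ?_, fun i hi hmi => ?_⟩
      · have : waiting cur rem v (m + 1) = waiting cur rem v m + rem m := by
          simp [waiting, sum_range_succ, hcm]
        rw [this, served, if_pos hcm]
        omega
      · by_cases him : i = m
        · subst him
          refine ⟨by simp [hcm], by simp, fun x hx => ?_⟩
          rw [Function.update_apply]
          by_cases hx' : x = o
          · simp [hx', hcm]
          · rw [if_neg (by omega), if_neg (fun h => hx' h.1), t3 x hx]
        · obtain ⟨d1, d2, d3⟩ := hdone i (by omega)
          refine ⟨by simp [him, d1], by simp [him, d2], fun x hx => ?_⟩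
          rw [Function.update_of_ne, d3 x hx]
          intro h
          exact him (row_inj hx hoN (by omega)).1
      · obtain ⟨d1, d2, d3⟩ := htodo i hi (by omega)
        have him : i ≠ m := by omega
        refine ⟨by simp [him, d1], by simp [him, d2], fun x hx => ?_⟩
        rw [Function.update_of_ne, d3 x hx]
        intro h
        exact him (row_inj hx hoN (by omega)).1
    · have hrun : serveClient.run s' = s' := by
        rw [serveClient, run_whenEq, if_neg]
        simpa [Expr.eval, hr, e6, t1] using hcm
      rw [hrun]
      refine ⟨?_, fun i hi => ?_, fun i hi hmi => htodo i hi (by omega)⟩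
      · rw [hreg]
        simp [waiting, sum_range_succ, hcm]
      · by_cases him : i = m
        · subst him
          exact ⟨by simp [hcm, t1], by simp [served, hcm, t2], fun x hx => by simp [hcm, t3 x hx]⟩
        · exact hdone i (by omega)

def assignLoop : FProg := .forN 5 (.reg 2) (block [
  .setReg 6 (.sub (.reg 2) (.add (.reg 5) (.lit 1))),
  .setReg 13 (.get 7 (.reg 6)),
  serveProg])

theorem assignLoop_arr {s : State} {N M : ℕ} {pa cp r : ℕ → ℕ} (hN : s.reg 2 = N)
    (hM : s.reg 3 = M) (hleN : N ≤ s.reg 0) (hle : M ≤ s.reg 0)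
    (hsort : Sorted N pa (s.arr 2) (s.arr 3) (s.arr 4))
    (h13 : ∀ i < M, s.arr 13 i = i * N) (hcur : ∀ i < M, s.arr 11 i = cp i)
    (hrem : ∀ i < M, s.arr 12 i = r i) (h1 : ∀ k, s.arr 1 k = 0) :
    ∀ i < M, ∀ x < N, (assignLoop.run s).arr 1 (i * N + x + 1) =
      assign (s.arr 4) cp (s.arr 7) N r i (s.arr 3 x) := by
  have key := FProg.run_forN (q := assignLoop) rfl (s := s) (m := N)
    (fun t s' => ∀ i < M, s'.arr 11 i = curAt (s.arr 4) cp N t i ∧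
      s'.arr 12 i = remAt (s.arr 4) cp (s.arr 7) N r t i ∧
      ∀ x < N, s'.arr 1 (i * N + x + 1) =
        if N - t ≤ s.arr 3 x then assign (s.arr 4) cp (s.arr 7) N r i (s.arr 3 x) else 0)
    rfl hleN (fun s' ha => (ha.reg 2 rfl).trans hN) (fun k s' x hk => hk) ?_ ?_
  · intro i hi x hx
    rw [(key i hi).2.2 x hx, if_pos (by omega)]
  · intro i hi
    refine ⟨hcur i hi, hrem i hi, fun x hx => ?_⟩
    have := hsort.pos_lt x hx
    rw [if_neg (by omega), h1]
  · intro t s' ht hr hag h i hi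
    have e2 := (hag.reg 2 rfl).trans hN
    have a7 := hag.arr 7 rfl
    simp only [run_block_cons, run_block_nil]
    set s1 := (FProg.setReg 13 (.get 7 (.reg 6))).run
      ((FProg.setReg 6 (.sub (.reg 2) (.add (.reg 5) (.lit 1)))).run s') with hs1
    set v := N - (t + 1) with hv
    have hvN : v < N := by omega
    obtain ⟨q1, q2, q3⟩ := serveProg_arr (s := s1) (N := N) (M := M) (v := v) (c := s.arr 7 v)
      (o := s.arr 2 v) (cur := curAt (s.arr 4) cp N t) (rem := remAt (s.arr 4) cp (s.arr 7) N r t)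
      ((hag.reg 3 rfl).trans hM) (by
        have : s1.reg 0 = s.reg 0 := hag.reg 0 rfl
        omega)
      (by simp [hs1, FProg.run, Expr.eval, e2, hr, hv])
      (by simp [hs1, FProg.run, Expr.eval, e2, hr, hv, a7])
      (congrFun (hag.arr 2 rfl) v) (hsort.ord_lt v hvN)
      (fun i hi => (congrFun (hag.arr 13 rfl) i).trans (h13 i hi))
      (fun i hi => (h i hi).1) (fun i hi => (h i hi).2.1) i hi
    refine ⟨?_, q2, fun x hx => ?_⟩
    · rw [q1]
      have : s1.arr 4 = s.arr 4 := hag.arr 4 rfl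
      rw [this, curAt]
    · rw [q3 x hx]
      have hold : s1.arr 1 (i * N + x + 1) = _ := (h i hi).2.2 x hx
      rw [hold]
      -- Output rows are indexed by original labels while visits are indexed by positions; `Sorted`
      -- translates between the two.
      have hxo : x = s.arr 2 v ↔ s.arr 3 x = v := by
        constructor
        · rintro rfl; exact hsort.pos_ord v hvN
        · intro h; rw [← h, hsort.ord_pos x hx]
      simp only [hxo]
      by_cases hxv : s.arr 3 x = v
      · have has : assign (s.arr 4) cp (s.arr 7) N r i (s.arr 3 x) =
            served (curAt (s.arr 4) cp N t) (remAt (s.arr 4) cp (s.arr 7) N r t)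
              (s.arr 7 v) v i := by
          rw [assign, hxv, show N - (v + 1) = t by omega]
        have e1 : ¬ N - t ≤ s.arr 3 x := by omega
        have e2 : v ≤ s.arr 3 x := by omega
        rw [if_neg e1, if_pos e2, has]
        by_cases hcv : curAt (s.arr 4) cp N t i = v
        · rw [if_pos ⟨hxv, hcv⟩]
        · rw [if_neg fun h => hcv h.2, served, if_neg hcv]
      · rw [if_neg fun h => hxv h.1]
        have : N - t ≤ s.arr 3 x ↔ v ≤ s.arr 3 x := by omega
        simp only [this]

/-! ### Correctness in terms of sorted positions -/

namespace Sorted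

variable {N : ℕ} {pa ord pos par : ℕ → ℕ}

theorem sum_ord (h : Sorted N pa ord pos par) (f : ℕ → ℕ) :
    ∑ v ∈ range N, f (ord v) = ∑ v ∈ range N, f v :=
  sum_nbij' ord pos (fun v hv => mem_range.2 (h.ord_lt v (mem_range.1 hv)))
    (fun v hv => mem_range.2 (h.pos_lt v (mem_range.1 hv)))
    (fun v hv => h.pos_ord v (mem_range.1 hv)) (fun v hv => h.ord_pos v (mem_range.1 hv))
    (fun _ _ => rfl)

theorem iterate_par (h : Sorted N pa ord pos par) (k : ℕ) {j : ℕ} (hj : j < N) :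
    par^[k] j < N ∧ ord (par^[k] j) = pa^[k] (ord j) := by
  induction k with
  | zero => exact ⟨hj, rfl⟩
  | succ k ih =>
    rw [Function.iterate_succ_apply', Function.iterate_succ_apply', ← ih.2, h.ord_par _ ih.1]
    exact ⟨(h.par_le _ ih.1).trans_lt ih.1, rfl⟩

theorem iterate_par_pos (h : Sorted N pa ord pos par) {k v s : ℕ} (hv : v < N) (hs : s < N) :
    par^[k] (pos v) = pos s ↔ pa^[k] v = s := by
  obtain ⟨h1, h2⟩ := h.iterate_par k (h.pos_lt v hv)
  rw [h.ord_pos v hv] at h2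
  rw [← h2]
  constructor
  · intro h3; rw [h3, h.ord_pos s hs]
  · rintro rfl; rw [h.pos_ord _ h1]

end Sorted

namespace Instance

variable (I : Instance)

/-- The parent map on natural numbers. -/
def natParent (v : ℕ) : ℕ := if h : v < I.numNodes then I.parent ⟨v, h⟩ else 0

/-- The parents of the clients, indexed by natural numbers. -/
def natClientParent (i : ℕ) : ℕ := if h : i < I.numClients then I.clientParent ⟨i, h⟩ else 0

/-- The requests of the clients, indexed by natural numbers. -/
def natRequests (i : ℕ) : ℕ := if h : i < I.numClients then I.requests ⟨i, h⟩ else 0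

theorem natParent_lt {v : ℕ} (h : v < I.numNodes) : I.natParent v < I.numNodes := by
  simp [natParent, h]

theorem natClientParent_lt {i : ℕ} (h : i < I.numClients) :
    I.natClientParent i < I.numNodes := by
  simp [natClientParent, h]

theorem natParent_iterate (k : ℕ) (v : Fin I.numNodes) :
    I.natParent^[k] v = (I.parent^[k] v : Fin I.numNodes) := by
  induction k generalizing v with
  | zero => rfl
  | succ k ih => simp only [Function.iterate_succ_apply, ← ih]; simp [natParent]

variable {I} {ord pos par : ℕ → ℕ}

theorem mem_ancestors_iff (hs : Sorted I.numNodes I.natParent ord pos par)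
    (i : Fin I.numClients) (s : Fin I.numNodes) :
    s ∈ I.ancestors i ↔ ∃ k, par^[k] (pos (I.natClientParent i)) = pos s := by
  refine exists_congr fun k => ?_
  rw [hs.iterate_par_pos (I.natClientParent_lt i.2) s.2]
  have : I.natClientParent i = I.clientParent i := by simp [natClientParent]
  rw [this, natParent_iterate, Fin.ext_iff]

/-- The replicas of `y`, moved to their positions, suffice: `y` itself is an assignment within the
masked capacities, as it serves nothing outside its replicas. -/
theorem feasible_of_isValid (hs : Sorted I.numNodes I.natParent ord pos par) {y : I.Assignment}
    (hy : I.IsValid y) :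
    Feasible par (fun _ => I.capacity) I.numNodes
      (fun v => waiting (fun i => pos (I.natClientParent i)) I.natRequests v I.numClients)
      (I.replicas y).card := by
  set Y : ℕ → ℕ → ℕ := fun i s =>
    if h : i < I.numClients ∧ s < I.numNodes then y ⟨i, h.1⟩ ⟨s, h.2⟩ else 0 with hY
  have hYf : ∀ (i : Fin I.numClients) (s : Fin I.numNodes), Y i s = y i s := fun i s => by
    simp [hY]
  refine ⟨(I.replicas y).image fun s : Fin I.numNodes => pos s, ?_, card_image_le, ?_⟩
  · intro x hx
    obtain ⟨s, -, rfl⟩ := mem_image.1 hx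
    exact mem_range.2 (hs.pos_lt s s.2)
  · refine flow_eq_zero_of_assignment hs.par_le hs.par_lt
      (fun i hi => hs.pos_lt _ (I.natClientParent_lt hi)) (fun i v => Y i (ord v)) ?_ ?_ ?_ 0
    · intro i hi v hv h0
      have h1 := hy.path ⟨i, hi⟩ ⟨ord v, hs.ord_lt v hv⟩ (by
        rw [← hYf]; exact h0)
      have := (mem_ancestors_iff hs _ _).1 h1
      simpa only [hs.pos_ord v hv] using this
    · intro i hi
      rw [hs.sum_ord (fun v => Y i v), sum_range]
      have := hy.served ⟨i, hi⟩
      simp only [natRequests, hi, dif_pos, ← this]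
      exact sum_congr rfl fun s _ => hYf ⟨i, hi⟩ s
    · intro v hv
      set s : Fin I.numNodes := ⟨ord v, hs.ord_lt v hv⟩ with hsv
      have hsum : ∑ i ∈ range I.numClients, Y i (ord v) = ∑ i, y i s := by
        rw [sum_range]
        exact sum_congr rfl fun i _ => hYf i s
      rw [hsum]
      by_cases hr : s ∈ I.replicas y
      · rw [mask, if_pos]
        · exact hy.capacity s hr
        · exact mem_image.2 ⟨s, hr, hs.pos_ord v hv⟩
      · have : ∀ i, y i s = 0 := by simpa [replicas] using hr
        simp [this]

/-- The assignment on positions, read as an assignment on nodes. -/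
def ofPositions (I : Instance) (pos : ℕ → ℕ) (z : ℕ → ℕ → ℕ) : I.Assignment :=
  fun i s => z i (pos s)

theorem isValid_ofPositions (hs : Sorted I.numNodes I.natParent ord pos par) {w : ℕ → ℕ}
    (hw : ∀ v < I.numNodes, w v ≤ I.capacity)
    (hflow : flow par w I.numNodes (fun v => waiting (fun i => pos (I.natClientParent i))
      I.natRequests v I.numClients) I.numNodes 0 = 0) :
    I.IsValid (I.ofPositions pos
      (assign par (fun i => pos (I.natClientParent i)) w I.numNodes I.natRequests)) := by
  refine ⟨fun i s h0 => ?_, fun i => ?_, fun s _ => ?_⟩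
  · exact (mem_ancestors_iff hs i s).2 (exists_iterate_of_assign_ne_zero
      (cp := fun i => pos (I.natClientParent i)) h0)
  · have h1 := sum_assign hs.par_le hs.par_lt
      (fun i hi => hs.pos_lt _ (I.natClientParent_lt hi)) hflow i.2
    simp only [ofPositions]
    rw [← sum_range (fun s => assign par (fun i => pos (I.natClientParent i)) w I.numNodes
      I.natRequests i (pos s)), ← hs.sum_ord]
    have h2 : I.natRequests i = I.requests i := by simp [natRequests]
    rw [← h2, ← h1]
    exact sum_congr rfl fun v hv => by rw [hs.pos_ord v (mem_range.1 hv)]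
  · refine le_trans ?_ (hw (pos s) (hs.pos_lt s s.2))
    refine le_trans (le_of_eq ?_) (sum_assign_le par (fun i => pos (I.natClientParent i)) w
      I.numNodes I.numClients I.natRequests (pos s))
    rw [sum_range]
    rfl

/-- A node of capacity zero serves nothing, so every replica sits at a position of nonzero capacity.
-/
theorem card_replicas_ofPositions_le (hs : Sorted I.numNodes I.natParent ord pos par)
    (w : ℕ → ℕ) :
    (I.replicas (I.ofPositions pos
      (assign par (fun i => pos (I.natClientParent i)) w I.numNodes I.natRequests))).card ≤
      #{v ∈ range I.numNodes | w v ≠ 0} := by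
  refine card_le_card_of_injOn (fun s => pos s) (fun s h => ?_) (fun s _ s' _ h => ?_)
  · obtain ⟨i, hi⟩ : ∃ i, I.ofPositions pos (assign par (fun i => pos (I.natClientParent i)) w
        I.numNodes I.natRequests) i s ≠ 0 := by simpa [replicas] using h
    have h1 := sum_assign_le par (fun i => pos (I.natClientParent i)) w
      I.numNodes I.numClients I.natRequests (pos s)
    have h2 := single_le_sum (f := fun i => assign par (fun i => pos (I.natClientParent i)) w
      I.numNodes I.natRequests i (pos s)) (fun _ _ => Nat.zero_le _) (mem_range.2 i.2)
    simp only [ofPositions] at hi h2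
    rw [mem_coe, mem_filter, mem_range]
    exact ⟨hs.pos_lt s s.2, by dsimp only; omega⟩
  · have := congrArg ord h
    simp only [hs.ord_pos s s.2, hs.ord_pos s' s'.2] at this
    exact Fin.ext this

end Instance

/-! ### The whole program and its correctness -/

def headProg : FProg := block [
  .setReg 1 (.get 0 (.lit 0)),
  .setReg 2 (.get 0 (.lit 1)),
  .setReg 3 (.get 0 (.lit 2))]

/-- Everything that precedes the computation of an assignment. -/
def prepProg : FProg := block [searchProg, rowsProg, offsetsProg, loadProg, fillProg, tableProg,
  leastProg]

/-- The computation of an assignment. -/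
def answerProg : FProg := block [
  thinProg,
  startProg,
  assignLoop,
  .setArr 1 (.lit 0) (.lit 1),
  .setReg 4 (.add (.get 13 (.reg 3)) (.lit 1))]

/-- The program that solves replica counting; the length of the output is left in register `4`. -/
def solveProg : FProg := block [
  headProg,
  prepProg,
  .ite (.reg 15) (.reg 0) answerProg (.setReg 4 (.lit 1))]

namespace Instance

variable (I : Instance)

theorem length_encode : I.encode.length = 4 + I.numNodes + I.numClients + I.numClients := by
  simp [encode]; omega

theorem encode_getD_parent {v : ℕ} (hv : v < I.numNodes) :
    I.encode.getD (4 + v) 0 = I.natParent v := by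
  simp [encode, natParent, hv, List.getElem?_append, add_comm 4 v]

theorem encode_getD_clientParent {i : ℕ} (hi : i < I.numClients) :
    I.encode.getD (4 + I.numNodes + i) 0 = I.natClientParent i := by
  simp [encode, natClientParent, hi, List.getElem?_append, add_comm 4, add_right_comm _ 4]

theorem encode_getD_requests {i : ℕ} (hi : i < I.numClients) :
    I.encode.getD (4 + I.numNodes + I.numClients + i) 0 = I.natRequests i := by
  have h1 : ¬ I.numNodes + I.numClients + i < I.numNodes := by omega
  have h2 : I.numNodes + I.numClients + i - I.numNodes = I.numClients + i := by omega
  simp [encode, natRequests, hi, List.getElem?_append, add_comm 4, add_right_comm _ 4, h1, h2]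

/-- What holds when the assignment is about to be computed. -/
structure Prepared (s : State) : Prop where
  reg_zero : s.reg 0 = 4 + I.numNodes + I.numClients + I.numClients
  reg_one : s.reg 1 = I.capacity
  reg_two : s.reg 2 = I.numNodes
  reg_three : s.reg 3 = I.numClients
  clientParent : ∀ i < I.numClients, s.arr 0 (4 + I.numNodes + i) = I.natClientParent i
  requests : ∀ i < I.numClients,
    s.arr 0 (4 + I.numNodes + I.numClients + i) = I.natRequests i
  output : ∀ k, s.arr 1 k = 0
  sorted : Sorted I.numNodes I.natParent (s.arr 2) (s.arr 3) (s.arr 4)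
  rows : ∀ v ≤ s.reg 0, s.arr 5 v = v * s.reg 0
  offsets : ∀ i ≤ I.numClients, s.arr 13 i = i * I.numNodes
  load : s.arr 6 = fun v =>
    waiting (fun i => s.arr 3 (I.natClientParent i)) I.natRequests v I.numClients
  full : ∀ v < I.numNodes, s.arr 7 v = I.capacity
  least_le : s.reg 15 ≤ s.reg 0
  least : s.reg 15 < s.reg 0 →
    table (s.arr 4) (fun _ => I.capacity) I.numNodes (s.arr 6) I.numNodes 0 (s.reg 15) = 0
  least_min : ∀ k < s.reg 0, k < s.reg 15 →
    table (s.arr 4) (fun _ => I.capacity) I.numNodes (s.arr 6) I.numNodes 0 k ≠ 0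

theorem numNodes_pos : 0 < I.numNodes := I.root.pos

theorem prepared : I.Prepared (prepProg.run (headProg.run (initState I.encode))) := by
  obtain ⟨s0, hs0⟩ : ∃ s0, s0 = headProg.run (initState I.encode) := ⟨_, rfl⟩
  obtain ⟨s1, hs1⟩ : ∃ s1, s1 = searchProg.run s0 := ⟨_, rfl⟩
  obtain ⟨s2, hs2⟩ : ∃ s2, s2 = rowsProg.run s1 := ⟨_, rfl⟩
  obtain ⟨s3, hs3⟩ : ∃ s3, s3 = offsetsProg.run s2 := ⟨_, rfl⟩
  obtain ⟨s4, hs4⟩ : ∃ s4, s4 = loadProg.run s3 := ⟨_, rfl⟩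
  obtain ⟨s5, hs5⟩ : ∃ s5, s5 = fillProg.run s4 := ⟨_, rfl⟩
  obtain ⟨s6, hs6⟩ : ∃ s6, s6 = tableProg.run s5 := ⟨_, rfl⟩
  obtain ⟨s7, hs7⟩ : ∃ s7, s7 = leastProg.run s6 := ⟨_, rfl⟩
  have A1 : FProg.Agree searchProg s0 s1 := hs1 ▸ FProg.agree_run _ _
  have A2 : FProg.Agree rowsProg s1 s2 := hs2 ▸ FProg.agree_run _ _
  have A3 : FProg.Agree offsetsProg s2 s3 := hs3 ▸ FProg.agree_run _ _
  have A4 : FProg.Agree loadProg s3 s4 := hs4 ▸ FProg.agree_run _ _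
  have A5 : FProg.Agree fillProg s4 s5 := hs5 ▸ FProg.agree_run _ _
  have A6 : FProg.Agree tableProg s5 s6 := hs6 ▸ FProg.agree_run _ _
  have A7 : FProg.Agree leastProg s6 s7 := hs7 ▸ FProg.agree_run _ _
  have hrun : prepProg.run (headProg.run (initState I.encode)) = s7 := by
    rw [hs7, hs6, hs5, hs4, hs3, hs2, hs1, hs0]
    simp only [prepProg, run_block_cons, run_block_nil]
  have a0 : ∀ k, s0.arr 0 k = I.encode.getD k 0 := fun k => by
    simp [hs0, headProg, FProg.run, initState]
  have az : ∀ x, x ≠ 0 → ∀ k, s0.arr x k = 0 := fun x hx k => by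
    simp [hs0, headProg, FProg.run, initState, hx]
  have r0 : s0.reg 0 = 4 + I.numNodes + I.numClients + I.numClients := by
    rw [← length_encode]
    simp [hs0, headProg, FProg.run, initState]
  have r1 : s0.reg 1 = I.capacity := by
    simp [hs0, headProg, FProg.run, initState, Expr.eval, encode]
  have r2 : s0.reg 2 = I.numNodes := by
    simp [hs0, headProg, FProg.run, initState, Expr.eval, encode]
  have r3 : s0.reg 3 = I.numClients := by
    simp [hs0, headProg, FProg.run, initState, Expr.eval, encode]
  have h3 : s0.arr 0 3 = I.root := by
    rw [a0]; simp [encode]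
  have hsort : Sorted I.numNodes I.natParent (s1.arr 2) (s1.arr 3) (s1.arr 4) := by
    rw [hs1]
    refine sorted_searchProg r2 (by omega) h3
      (fun v hv => (a0 _).trans (I.encode_getD_parent hv)) (az 4 (by norm_num) 0) ?_ I.root.2
      (fun v hv => I.natParent_lt hv) ?_
    · simp [natParent, I.parent_root]
    · intro v hv
      obtain ⟨k, hk⟩ := I.reaches_root ⟨v, hv⟩
      exact ⟨k, by rw [← hk]; exact I.natParent_iterate k ⟨v, hv⟩⟩
  have f0 : s1.reg 0 = s0.reg 0 := by
    rw [A1.reg 0 rfl]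
  have f5 : s1.arr 5 = s0.arr 5 := by
    rw [A1.arr 5 rfl]
  have hrows := rowsProg_arr (s := s1) (by rw [f5, az 5 (by norm_num)])
  rw [← hs2] at hrows
  have g0 : s2.reg 0 = s0.reg 0 := by
    rw [A2.reg 0 rfl, A1.reg 0 rfl]
  have g2 : s2.reg 2 = s0.reg 2 := by
    rw [A2.reg 2 rfl, A1.reg 2 rfl]
  have g3 : s2.reg 3 = s0.reg 3 := by
    rw [A2.reg 3 rfl, A1.reg 3 rfl]
  have g13 : s2.arr 13 = s0.arr 13 := by
    rw [A2.arr 13 rfl, A1.arr 13 rfl]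
  have hoff := offsetsProg_arr (s := s2) (by rw [g13, az 13 (by norm_num)])
    (by rw [g3, g0, r0, r3]; omega)
  rw [← hs3] at hoff
  have k0 : s3.reg 0 = s0.reg 0 := by
    rw [A3.reg 0 rfl, A2.reg 0 rfl, A1.reg 0 rfl]
  have k2 : s3.reg 2 = s0.reg 2 := by
    rw [A3.reg 2 rfl, A2.reg 2 rfl, A1.reg 2 rfl]
  have k3 : s3.reg 3 = s0.reg 3 := by
    rw [A3.reg 3 rfl, A2.reg 3 rfl, A1.reg 3 rfl]
  have ka0 : s3.arr 0 = s0.arr 0 := by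
    rw [A3.arr 0 rfl, A2.arr 0 rfl, A1.arr 0 rfl]
  have ka3 : s3.arr 3 = s1.arr 3 := by
    rw [A3.arr 3 rfl, A2.arr 3 rfl]
  have ka6 : s3.arr 6 = s0.arr 6 := by
    rw [A3.arr 6 rfl, A2.arr 6 rfl, A1.arr 6 rfl]
  have hload := loadProg_arr (s := s3) (M := I.numClients)
    (cp := fun i => s1.arr 3 (I.natClientParent i)) (r := I.natRequests) (k3.trans r3)
    (fun v => by rw [ka6, az 6 (by norm_num)]) (by rw [k0, r0]; omega)
    (fun i hi => by rw [ka3, ka0, k2, r2, a0, I.encode_getD_clientParent hi])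
    (fun i hi => by rw [ka0, k2, r2, a0, I.encode_getD_requests hi])
  rw [← hs4] at hload
  have l0 : s4.reg 0 = s0.reg 0 := by
    rw [A4.reg 0 rfl, A3.reg 0 rfl, A2.reg 0 rfl, A1.reg 0 rfl]
  have l1 : s4.reg 1 = s0.reg 1 := by
    rw [A4.reg 1 rfl, A3.reg 1 rfl, A2.reg 1 rfl, A1.reg 1 rfl]
  have l2 : s4.reg 2 = s0.reg 2 := by
    rw [A4.reg 2 rfl, A3.reg 2 rfl, A2.reg 2 rfl, A1.reg 2 rfl]
  have hfill := fillProg_arr (s := s4) (by rw [l0, l2, r0, r2]; omega)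
  rw [l1, l2, r1, r2, ← hs5] at hfill
  have m0 : s5.reg 0 = s0.reg 0 := by
    rw [A5.reg 0 rfl, A4.reg 0 rfl, A3.reg 0 rfl, A2.reg 0 rfl, A1.reg 0 rfl]
  have m2 : s5.reg 2 = s0.reg 2 := by
    rw [A5.reg 2 rfl, A4.reg 2 rfl, A3.reg 2 rfl, A2.reg 2 rfl, A1.reg 2 rfl]
  have m4 : s5.arr 4 = s1.arr 4 := by
    rw [A5.arr 4 rfl, A4.arr 4 rfl, A3.arr 4 rfl, A2.arr 4 rfl]
  have m5 : s5.arr 5 = s2.arr 5 := by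
    rw [A5.arr 5 rfl, A4.arr 5 rfl, A3.arr 5 rfl]
  have m6 : s5.arr 6 = s4.arr 6 := by
    rw [A5.arr 6 rfl]
  have htab := tableProg_arr (s := s5) (n := s0.reg 0) (N := I.numNodes) m0 (m2.trans r2)
    (by omega) (by rw [m4]; exact hsort.par_le) (by rw [m5, ← f0]; exact hrows) 0 I.numNodes_pos
  simp only [zero_mul, zero_add] at htab
  rw [table_congr le_rfl hfill, ← hs6] at htab
  have hleast := leastProg_reg (s := s6) (n := s0.reg 0) ((A6.reg 0 rfl).trans m0)
  rw [← hs7] at hleast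
  have n0 : s7.reg 0 = s0.reg 0 := by
    rw [A7.reg 0 rfl, A6.reg 0 rfl, A5.reg 0 rfl, A4.reg 0 rfl, A3.reg 0 rfl, A2.reg 0 rfl, A1.reg 0 rfl]
  have na0 : s7.arr 0 = s0.arr 0 := by
    rw [A7.arr 0 rfl, A6.arr 0 rfl, A5.arr 0 rfl, A4.arr 0 rfl, A3.arr 0 rfl, A2.arr 0 rfl, A1.arr 0 rfl]
  have n2 : s7.arr 2 = s1.arr 2 := by
    rw [A7.arr 2 rfl, A6.arr 2 rfl, A5.arr 2 rfl, A4.arr 2 rfl, A3.arr 2 rfl, A2.arr 2 rfl]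
  have n3 : s7.arr 3 = s1.arr 3 := by
    rw [A7.arr 3 rfl, A6.arr 3 rfl, A5.arr 3 rfl, A4.arr 3 rfl, A3.arr 3 rfl, A2.arr 3 rfl]
  have n4 : s7.arr 4 = s1.arr 4 := by
    rw [A7.arr 4 rfl, A6.arr 4 rfl, A5.arr 4 rfl, A4.arr 4 rfl, A3.arr 4 rfl, A2.arr 4 rfl]
  have n4' : s5.arr 4 = s7.arr 4 := m4.trans n4.symm
  have n6 : s7.arr 6 = s5.arr 6 := by
    rw [A7.arr 6 rfl, A6.arr 6 rfl]
  have c : ∀ x, searchProg.writesReg x = false → rowsProg.writesReg x = false →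
      offsetsProg.writesReg x = false → loadProg.writesReg x = false →
      fillProg.writesReg x = false → tableProg.writesReg x = false →
      leastProg.writesReg x = false → s7.reg x = s0.reg x := fun x h1 h2 h3 h4 h5 h6 h7 => by
    rw [A7.reg x h7, A6.reg x h6, A5.reg x h5, A4.reg x h4, A3.reg x h3, A2.reg x h2, A1.reg x h1]
  rw [hrun]
  refine ⟨n0.trans r0, by rw [c 1 rfl rfl rfl rfl rfl rfl rfl, r1],
    by rw [c 2 rfl rfl rfl rfl rfl rfl rfl, r2], by rw [c 3 rfl rfl rfl rfl rfl rfl rfl, r3],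
    fun i hi => ?_, fun i hi => ?_, fun k => ?_, ?_, ?_, ?_, ?_, ?_, ?_, ?_, ?_⟩
  · rw [na0, a0, I.encode_getD_clientParent hi]
  · rw [na0, a0, I.encode_getD_requests hi]
  · rw [A7.arr 1 rfl, A6.arr 1 rfl, A5.arr 1 rfl, A4.arr 1 rfl, A3.arr 1 rfl, A2.arr 1 rfl,
      A1.arr 1 rfl, az 1 (by norm_num)]
  · rwa [n2, n3, n4]
  · have : s7.arr 5 = s2.arr 5 := by
      rw [A7.arr 5 rfl, A6.arr 5 rfl, A5.arr 5 rfl, A4.arr 5 rfl, A3.arr 5 rfl]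
    rw [this, n0, ← f0]
    exact hrows
  · have : s7.arr 13 = s3.arr 13 := by
      rw [A7.arr 13 rfl, A6.arr 13 rfl, A5.arr 13 rfl, A4.arr 13 rfl]
    rw [this, ← r2, ← r3, ← g2, ← g3]
    exact hoff
  · rw [n6, m6, n3]
    exact hload
  · have : s7.arr 7 = s5.arr 7 := by
      rw [A7.arr 7 rfl, A6.arr 7 rfl]
    rw [this]
    exact hfill
  · rw [n0]; exact hleast.1
  · rw [n0, n6, ← n4']
    intro h
    rw [← htab _ h]
    exact hleast.2.1 h
  · rw [n0, n6, ← n4']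
    intro k hk hk'
    rw [← htab _ hk]
    exact hleast.2.2 k hk hk'

variable {I}

/-- `thin_spec` for the optimal budget that the preparation leaves in register `15`. -/
theorem Prepared.capacities {s : State} (h : I.Prepared s) (hK : s.reg 15 < s.reg 0) :
    flow (s.arr 4) ((thinProg.run s).arr 7) I.numNodes (s.arr 6) I.numNodes 0 = 0 ∧
      #{v ∈ range I.numNodes | (thinProg.run s).arr 7 v ≠ 0} ≤ s.reg 15 ∧
      ∀ v < I.numNodes, (thinProg.run s).arr 7 v ≤ I.capacity := by
  have h0 := h.reg_zero
  have hthin := thinProg_arr rfl h.reg_two h.reg_one rfl hK (by omega) h.sorted.par_le h.rows h.full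
  obtain ⟨h1, h2⟩ := thin_spec h.sorted.par_le I.numNodes_pos (h.least hK)
    (fun k hk => h.least_min k (by omega) hk)
  refine ⟨?_, ?_, fun v hv => ?_⟩
  · exact (congrFun (flow_congr le_rfl fun v _ hv => hthin v hv) 0).trans h1
  · refine le_trans (le_of_eq (congrArg card (filter_congr fun v hv => ?_))) h2
    rw [hthin v (mem_range.1 hv)]
  · rw [hthin v hv]
    exact thin_le_thin (Nat.zero_le _) v

theorem output_eq_encodeAnswer {s : State} {y : I.Assignment}
    (h0 : s.reg 0 = I.numClients * I.numNodes + 1) (h1 : s.arr 1 0 = 1)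
    (h : ∀ (i : Fin I.numClients) (x : Fin I.numNodes), s.arr 1 (i * I.numNodes + x + 1) = y i x) :
    s.output = I.encodeAnswer (some y) := by
  rw [State.output, h0, List.range_succ_eq_map]
  simp only [encodeAnswer, List.map_cons, h1, List.map_map, List.cons.injEq, true_and]
  have hmap : ∀ (m : ℕ) (f : ℕ → ℕ), (List.range m).map f = List.ofFn fun i : Fin m => f i :=
    fun m f => List.ext_getElem (by simp) (by simp)
  rw [hmap, List.ofFn_mul]
  simp [h]

theorem solveProg_correct (I : Instance) :
    ∃ a : Option I.Assignment,
      ((solveProg.run (initState I.encode)).setReg 0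
        ((solveProg.run (initState I.encode)).reg 4)).output = I.encodeAnswer a ∧
      (a = none → ¬ ∃ y : I.Assignment, I.IsValid y) ∧
      ∀ y : I.Assignment, a = some y → I.IsOptimal y := by
  have hP := I.prepared
  simp only [solveProg, run_block_cons, run_block_nil]
  generalize prepProg.run (headProg.run (initState I.encode)) = s at hP ⊢
  -- Every valid solution forces a zero of the root row within its number of replicas. The zero has
  -- index at most the number of nodes, hence below the length of the input, so it is seen by the
  -- search for the least zero. This gives both optimality and the correctness of the answer that
  -- there is no solution.
  have hfeas : ∀ y : I.Assignment, I.IsValid y → ∃ k ≤ (I.replicas y).card, k < s.reg 0 ∧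
      table (s.arr 4) (fun _ => I.capacity) I.numNodes (s.arr 6) I.numNodes 0 k = 0 := by
    intro y hy
    have h1 := feasible_of_isValid hP.sorted hy
    rw [← hP.load] at h1
    obtain ⟨k, hk, hkN, h2⟩ := exists_table_of_feasible hP.sorted.par_le I.numNodes_pos h1
    exact ⟨k, hk, by rw [hP.reg_zero]; omega, h2⟩
  by_cases hK : s.reg 15 < s.reg 0
  · have hrun : (FProg.ite (.reg 15) (.reg 0) answerProg (.setReg 4 (.lit 1))).run s =
        answerProg.run s := if_pos hK
    rw [hrun]
    obtain ⟨c1, c2, c3⟩ := hP.capacities hK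
    obtain ⟨t1, ht1⟩ : ∃ t1, t1 = thinProg.run s := ⟨_, rfl⟩
    obtain ⟨t2, ht2⟩ : ∃ t2, t2 = startProg.run t1 := ⟨_, rfl⟩
    obtain ⟨t3, ht3⟩ : ∃ t3, t3 = assignLoop.run t2 := ⟨_, rfl⟩
    have A1 : FProg.Agree thinProg s t1 := ht1 ▸ FProg.agree_run _ _
    have A2 : FProg.Agree startProg t1 t2 := ht2 ▸ FProg.agree_run _ _
    have A3 : FProg.Agree assignLoop t2 t3 := ht3 ▸ FProg.agree_run _ _
    have hans : answerProg.run s = (t3.setArr 1 0 1).setReg 4 (t3.arr 13 (t3.reg 3) + 1) := by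
      simp only [answerProg, run_block_cons, run_block_nil, ← ht1, ← ht2, ← ht3]
      simp [FProg.run, Expr.eval]
    have b : ∀ x, thinProg.writesArr x = false → startProg.writesArr x = false →
        t2.arr x = s.arr x := fun x h1 h2 => by rw [A2.arr x h2, A1.arr x h1]
    have q : ∀ x, thinProg.writesReg x = false → startProg.writesReg x = false →
        t2.reg x = s.reg x := fun x h1 h2 => by rw [A2.reg x h2, A1.reg x h1]
    have b7 : t2.arr 7 = t1.arr 7 := A2.arr 7 rfl
    rw [← ht1] at c1 c2 c3
    have h0 := hP.reg_zero
    have hstart := startProg_arr (s := t1) (cp := fun i => s.arr 3 (I.natClientParent i))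
      (r := I.natRequests) (M := I.numClients) ((A1.reg 3 rfl).trans hP.reg_three)
      (by rw [A1.reg 0 rfl]; omega)
      (fun i hi => by
        rw [A1.arr 3 rfl, A1.arr 0 rfl, A1.reg 2 rfl, hP.reg_two,
          hP.clientParent i hi])
      (fun i hi => by
        rw [A1.arr 0 rfl, A1.reg 2 rfl, hP.reg_two, hP.requests i hi])
    rw [← ht2] at hstart
    have hassign := assignLoop_arr (s := t2) (N := I.numNodes) (M := I.numClients)
      (pa := I.natParent) (cp := fun i => s.arr 3 (I.natClientParent i)) (r := I.natRequests)
      ((q 2 rfl rfl).trans hP.reg_two) ((q 3 rfl rfl).trans hP.reg_three) (by rw [q 0 rfl rfl]; omega)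
      (by rw [q 0 rfl rfl]; omega) (by rw [b 2 rfl rfl, b 3 rfl rfl, b 4 rfl rfl]; exact hP.sorted)
      (fun i hi => by rw [b 13 rfl rfl, hP.offsets i hi.le]) (fun i hi => (hstart i hi).1)
      (fun i hi => (hstart i hi).2) (fun k => by rw [b 1 rfl rfl, hP.output])
    rw [b 4 rfl rfl, b 3 rfl rfl, b7, ← ht3] at hassign
    rw [hP.load] at c1
    set y := I.ofPositions (s.arr 3) (assign (s.arr 4) (fun i => s.arr 3 (I.natClientParent i))
      (t1.arr 7) I.numNodes I.natRequests) with hy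
    have hvalid : I.IsValid y := isValid_ofPositions hP.sorted c3 c1
    refine ⟨some y, ?_, by simp, ?_⟩
    · rw [hans]
      refine output_eq_encodeAnswer ?_ (by simp) fun i x => ?_
      · have e3 : t3.reg 3 = I.numClients :=
          (A3.reg 3 rfl).trans ((q 3 rfl rfl).trans hP.reg_three)
        have e13 : t3.arr 13 = s.arr 13 := (A3.arr 13 rfl).trans (b 13 rfl rfl)
        simp [e3, e13, hP.offsets I.numClients le_rfl]
      · simpa [hy, Instance.ofPositions] using hassign i i.2 x x.2
    · rintro y' ⟨⟩
      refine ⟨hvalid, fun y' hy' => ?_⟩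
      refine ((card_replicas_ofPositions_le hP.sorted _).trans c2).trans ?_
      obtain ⟨k, hk, hkn, h2⟩ := hfeas y' hy'
      by_contra hc
      exact hP.least_min k hkn (by omega) h2
  · have hrun : (FProg.ite (.reg 15) (.reg 0) answerProg (.setReg 4 (.lit 1))).run s =
        (FProg.setReg 4 (.lit 1)).run s := if_neg hK
    rw [hrun]
    refine ⟨none, ?_, fun _ => ?_, by simp⟩
    · simp [FProg.run, Expr.eval, State.output, encodeAnswer, hP.output]
    · rintro ⟨y, hy⟩
      obtain ⟨k, -, hkn, h2⟩ := hfeas y hy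
      exact hP.least_min k hkn (by omega) h2

/-- The output table has one entry per client and node, and both numbers are bounded by the number
of input words because every node and every client contributes words of its own. -/
theorem length_encodeAnswer_le (I : Instance) (a : Option I.Assignment) :
    (I.encodeAnswer a).length ≤ I.encode.length * I.encode.length + 1 := by
  cases a with
  | none => simp [encodeAnswer]
  | some y =>
    have : (I.encodeAnswer (some y)).length = I.numClients * I.numNodes + 1 := by
      simp [encodeAnswer, List.length_flatten, List.map_ofFn, Function.comp_def]
    rw [this, length_encode]
    exact Nat.add_le_add_right (Nat.mul_le_mul (by omega) (by omega)) 1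

end Instance

end ReplicaCounting

theorem mainTheorem1 :
    ∃ solve : (I : ReplicaCounting.Instance) → Option I.Assignment,
      RAM.PolyTimeComputable ReplicaCounting.Instance.encode
        ReplicaCounting.Instance.encodeAnswer solve ∧
      ∀ I : ReplicaCounting.Instance,
        (solve I = none → ¬ ∃ y : I.Assignment, I.IsValid y) ∧
        ∀ y : I.Assignment, solve I = some y → I.IsOptimal y := by
  -- The function is read off from the output of the program, instance by instance, so that
  -- computability holds by construction.
  choose solve hout hnone hsome using ReplicaCounting.Instance.solveProg_correct
  refine ⟨solve, ?_, fun I => ⟨hnone I, hsome I⟩⟩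
  obtain ⟨P, pol, h⟩ := RAM.exists_polynomial_time ReplicaCounting.solveProg rfl rfl 4
    (.X * .X + 1)
  refine ⟨P, pol, fun I => ?_⟩
  obtain ⟨t, h1, h2⟩ := h I.encode (by
    rw [hout]
    refine (I.length_encodeAnswer_le _).trans ?_
    have := RAM.length_le_bitSize I.encode
    simpa using Nat.mul_le_mul this this)
  exact ⟨t, _, h1, hout I, by rwa [hout] at h2⟩
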